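/- Consider the continuous-time linear system $\dot x=Ax+Bu+Dw$, $z=Cx+Eu$ with real matrices, $x\in\mathbb R^m$, $u\in\mathbb R^d$, $w\in\mathbb R^n$, $z\in\mathbb R^l$, where $E^\top C=0$ and $R:=E^\top E>0$, and let $\gamma>0$. For a gain $K\in\mathbb R^{d\times m}$ (state feedback $u=-Kx$) let $\mathcal T(K)(s)=(C-EK)(sI-A+BK)^{-1}D$ be the closed-loop transfer function from $w$ to $z$, let $\|\mathcal T(K)\|_\infty=\sup_{\omega\in\mathbb R}\sigma_{\max}[\mathcal T(K)(j\omega)]$, and let $$\mathcal K=\{K : A-BK \text{ is Hurwitz and } \|\mathcal T(K)\|_\infty<\gamma\}.$$ For $K\in\mathcal K$ let $P_K\ge 0$ be the unique stabilizing solution of $$(A-BK)^\top P_K+P_K(A-BK)+C^\top C+K^\top RK+\gamma^{-2}P_KDD^\top P_K=0,$$ i.e. the one for which $A-BK+\gamma^{-2}DD^\top P_K$ is Hurwitz, and let $\mathcal J(K)=\operatorname{tr}(P_KDD^\top)$. Consider, with stepsize $\eta>0$, the updates - natural policy gradient: $K'=K-2\eta(RK-B^\top P_K)$, with $\eta\le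 1/(2\|R\|)$ ($\|\cdot\|$ the spectral norm); - Gauss–Newton: $K'=K-2\eta(K-R^{-1}B^\top P_K)$, with $\eta\le 1/2$. **Theorem A.3 (Local (Super-)Linear Convergence, Continuous Time).** Suppose that $\mathcal K\neq\emptyset$, that $(A,C)$ is detectable, and that $DD^\top>0$. Then $P_K$ is well defined for every $K\in\mathcal K$; $\mathcal J$ has a unique minimizer $K^*$ over $\mathcal K$, and $K^*=R^{-1}B^\top P_{K^*}$. For each of the two updates, with any admissible stepsize $\eta$, and from every initial gain $K_0\in\mathcal K$, the iterates $K_k$ stay in $\mathcal K$, $K_k\to K^*$ and $\mathcal J(K_k)\to\mathcal J(K^*)$, and the convergence of $\mathcal J$ is locally linear: there are $\rho\in(0,1)$ and $r>0$ such that $$\mathcal J(K')-\mathcal J(K^*)\le\rho\,\bigl(\mathcal J(K)-\mathcal J(K^*)\bigr)\quad\text{for all } K\in\mathcal K \text{ with } \|K-K^*\|<r,$$ where $K'$ is the update of $K$; and, with the same $\rho$, for every $K_0\in\mathcal K$ one has $\mathcal J(K_{k+1})-\mathcal J(K^*)\le\rho\,(\mathcal J(K_k)-\mathcal J(K^*))$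 for all sufficiently large $k$. For the Gauss–Newton update with $\eta=1/2$ the convergence is moreover locally Q-quadratic, both in the objective and in the gain: there are $c>0$ and $r>0$ such that $$\mathcal J(K')-\mathcal J(K^*)\le c\,\bigl(\mathcal J(K)-\mathcal J(K^*)\bigr)^2,\qquad \|K'-K^*\|\le c\,\|K-K^*\|^2$$ for all $K\in\mathcal K$ with $\|K-K^*\|<r$; and, with the same $c$, for every $K_0\in\mathcal K$ both inequalities hold with $K=K_k$, $K'=K_{k+1}$ for all sufficiently large $k$. -/

import Mathlib

open Filter Topology
open scoped Matrix Matrix.Norms.L2Operator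

/- All norms of matrices below are spectral norms: operator norms between Euclidean spaces, that is,
largest singular values. -/

/-- A real square matrix is Hurwitz: all its complex eigenvalues have negative real part. -/
def IsHurwitz {m : ℕ} (M : Matrix (Fin m) (Fin m) ℝ) : Prop :=
  ∀ z ∈ spectrum ℂ (M.map Complex.ofReal), z.re < 0

/-- `(A, C)` is detectable: some output injection makes `A - L C` Hurwitz. -/
def IsDetectable {m l : ℕ} (A : Matrix (Fin m) (Fin m) ℝ) (C : Matrix (Fin l) (Fin m) ℝ) : Prop :=
  ∃ L : Matrix (Fin m) (Fin l) ℝ, IsHurwitz (A - L * C)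

/-- The transfer function `s ↦ C (s I - A)⁻¹ B` of `x' = A x + B u`, `z = C x`. -/
noncomputable def transferFunction {m n l : ℕ} (A : Matrix (Fin m) (Fin m) ℝ)
    (B : Matrix (Fin m) (Fin n) ℝ) (C : Matrix (Fin l) (Fin m) ℝ) (s : ℂ) :
    Matrix (Fin l) (Fin n) ℂ :=
  C.map Complex.ofReal * (s • (1 : Matrix (Fin m) (Fin m) ℂ) - A.map Complex.ofReal)⁻¹ *
    B.map Complex.ofReal

/-- The continuous-time `H∞`-norm `sup_ω σ_max (G (j ω))`, as an extended nonnegative number. -/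
noncomputable def hinfNorm {n l : ℕ} (G : ℂ → Matrix (Fin l) (Fin n) ℂ) : ENNReal :=
  ⨆ ω : ℝ, ENNReal.ofReal ‖G (Complex.I * (ω : ℂ))‖

/-- Data of a continuous-time mixed `H₂/H∞` design problem: the system
`x' = A x + B u + D w`, `z = C x + E u`, and the attenuation level `γ`. -/
structure MixedDesign (m d n l : ℕ) where
  A : Matrix (Fin m) (Fin m) ℝ
  B : Matrix (Fin m) (Fin d) ℝ
  C : Matrix (Fin l) (Fin m) ℝ
  D : Matrix (Fin m) (Fin n) ℝ
  E : Matrix (Fin l) (Fin d) ℝ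
  γ : ℝ

namespace MixedDesign

variable {m d n l : ℕ} (S : MixedDesign m d n l)

/-- The control weight `R = Eᵀ E`. -/
def R : Matrix (Fin d) (Fin d) ℝ := S.Eᵀ * S.E

/-- The closed-loop transfer function from `w` to `z` under the state feedback `u = -K x`. -/
noncomputable def closedLoop (K : Matrix (Fin d) (Fin m) ℝ) : ℂ → Matrix (Fin l) (Fin n) ℂ :=
  transferFunction (S.A - S.B * K) S.D (S.C - S.E * K)

/-- The feasible gains: stabilizing, with closed-loop `H∞`-norm less than `γ`. -/
def feasible : Set (Matrix (Fin d) (Fin m) ℝ) :=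
  {K | IsHurwitz (S.A - S.B * K) ∧ hinfNorm (S.closedLoop K) < ENNReal.ofReal S.γ}

/-- `P` is a stabilizing nonnegative definite solution of the Riccati equation of the gain `K`. -/
def IsStabilizingSolution (K : Matrix (Fin d) (Fin m) ℝ) (P : Matrix (Fin m) (Fin m) ℝ) : Prop :=
  P.PosSemidef ∧
  (S.A - S.B * K)ᵀ * P + P * (S.A - S.B * K) + S.Cᵀ * S.C + Kᵀ * S.R * K
      + (S.γ ^ 2)⁻¹ • (P * (S.D * S.Dᵀ) * P) = 0 ∧
  IsHurwitz (S.A - S.B * K + (S.γ ^ 2)⁻¹ • (S.D * S.Dᵀ * P))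

open Classical in
/-- The matrix `P_K`: the stabilizing solution of the Riccati equation (`0` if there is none). -/
noncomputable def P (K : Matrix (Fin d) (Fin m) ℝ) : Matrix (Fin m) (Fin m) ℝ :=
  if h : ∃ P, S.IsStabilizingSolution K P then h.choose else 0

/-- The cost `J(K) = tr (P_K D Dᵀ)`. -/
noncomputable def cost (K : Matrix (Fin d) (Fin m) ℝ) : ℝ := (S.P K * (S.D * S.Dᵀ)).trace

/-- One step of the natural policy gradient update with stepsize `η`. -/
noncomputable def npgStep (η : ℝ) (K : Matrix (Fin d) (Fin m) ℝ) : Matrix (Fin d) (Fin m) ℝ :=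
  K - (2 * η) • (S.R * K - S.Bᵀ * S.P K)

/-- One step of the Gauss-Newton update with stepsize `η`. -/
noncomputable def gnStep (η : ℝ) (K : Matrix (Fin d) (Fin m) ℝ) : Matrix (Fin d) (Fin m) ℝ :=
  K - (2 * η) • (K - S.R⁻¹ * S.Bᵀ * S.P K)

/-- `K` is the unique minimizer of the cost over the feasible gains. -/
def IsUniqueOptimum (K : Matrix (Fin d) (Fin m) ℝ) : Prop :=
  K ∈ S.feasible ∧ ∀ K' ∈ S.feasible, K' ≠ K → S.cost K < S.cost K'

/-- From every feasible initial gain the iterates of `step` stay feasible and converge to `Ks`, and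
their costs converge to that of `Ks`. -/
def ConvergesTo (step : Matrix (Fin d) (Fin m) ℝ → Matrix (Fin d) (Fin m) ℝ)
    (Ks : Matrix (Fin d) (Fin m) ℝ) : Prop :=
  ∀ K₀ ∈ S.feasible, (∀ k : ℕ, step^[k] K₀ ∈ S.feasible) ∧
    Tendsto (fun k : ℕ => step^[k] K₀) atTop (𝓝 Ks) ∧
    Tendsto (fun k : ℕ => S.cost (step^[k] K₀)) atTop (𝓝 (S.cost Ks))

/-- Local contraction of an error `err ≥ 0` under `step`, of the form
`err (step K) ≤ c * err K ^ p`: it holds for all feasible gains in a ball around `Ks`, and, with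
the same constant, along every feasibly initialized sequence of iterates from some index on. -/
def LocalRate (step : Matrix (Fin d) (Fin m) ℝ → Matrix (Fin d) (Fin m) ℝ)
    (Ks : Matrix (Fin d) (Fin m) ℝ) (err : Matrix (Fin d) (Fin m) ℝ → ℝ) (c : ℝ) (p : ℕ) : Prop :=
  (∃ r : ℝ, 0 < r ∧ ∀ K ∈ S.feasible, ‖K - Ks‖ < r → err (step K) ≤ c * err K ^ p) ∧
  ∀ K₀ ∈ S.feasible, ∃ N : ℕ, ∀ k ≥ N,
    err (step^[k + 1] K₀) ≤ c * err (step^[k] K₀) ^ p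

end MixedDesign

/-! Two facts carry the proof. The first is the strict bounded real lemma: since $DD^\top>0$, put
$W=\gamma^{-2}DD^\top$; the $H_\infty$ bound becomes the inequality $Q_K<(s-A_K)^*W^{-1}(s-A_K)$ on
the imaginary axis, with $A_K=A-BK$ and $Q_K=C^\top C+K^\top RK$. Completing the square
(`trace_freq_eq`) ties this inequality to the Riccati equation, and a continuity argument in $tQ_K$,
$0\le t\le1$, produces $P_K$ (`exists_isStab`). Conversely a stabilizing solution gives the
inequality with a uniform margin (`IsStab.exists_freq_bound`).

The second is a completion of squares in the gain (`gainRic_eq`): the Riccati expression of $K$ at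
$P$ is the game Riccati expression, which does not involve $K$, plus $E^\top R^{-1}E$ with
$E=RK-B^\top P$. Both updates have the form $K'=K-ME$ with $M+M^\top-M^\top RM\ge c>0$, so $P_K$ is
a supersolution for $K'$. Hence $K'$ is feasible and $P_{K'}\le P_K$ (`improvement`). The $P_{K_k}$
decrease to some $L\ge0$, the decrease of their traces forces $E\to0$, and $L$ solves the game
equation. A solution lying below some $P_K$ is stabilizing (`isStab_game`), and stabilizing
solutions are unique, so the limit does not depend on the initial gain, and $K^*=R^{-1}B^\top L$.

For the rates, expand the game equation at $L$. Its linear part is an invertible Lyapunov operator,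
so near the optimum $\|P_K-L\|$ is at most a multiple of $\|E\|^2$, and also of $\|K-K^*\|^2$. One
step lowers the cost by at least a multiple of $\|E\|^2$, which gives linear convergence. For
Gauss–Newton with $\eta=1/2$, $K'=R^{-1}B^\top P_K$, so $K'-K^*$ is linear in $P_K-L$; this gives
both quadratic rates. -/

/-! ### Complex eigenvectors as real two-column matrices -/

section ComplexVectors

variable {m n : ℕ}

/-- The complex vector `a + i b` represented by the real matrix with columns `a` and `b`. -/
def complexVec (V : Matrix (Fin m) (Fin 2) ℝ) : Fin m → ℂ := fun i => ⟨V i 0, V i 1⟩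

/-- The real `2 × 2` matrix by which multiplication with `z` acts on columns `[re, im]`. -/
def rot (z : ℂ) : Matrix (Fin 2) (Fin 2) ℝ := !![z.re, z.im; -z.im, z.re]

theorem complexVec_injective : Function.Injective (complexVec (m := m)) := by
  intro V V' h
  ext i j
  have hi := congrFun h i
  simp only [complexVec, Complex.mk.injEq] at hi
  fin_cases j
  · exact hi.1
  · exact hi.2

theorem complexVec_surjective : Function.Surjective (complexVec (m := m)) := fun v =>
  ⟨fun i => ![(v i).re, (v i).im], by ext i; simp [complexVec]⟩

theorem complexVec_zero : complexVec (0 : Matrix (Fin m) (Fin 2) ℝ) = 0 := by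
  ext i; simp [complexVec]; rfl

theorem complexVec_eq_zero {V : Matrix (Fin m) (Fin 2) ℝ} : complexVec V = 0 ↔ V = 0 := by
  rw [← complexVec_zero, complexVec_injective.eq_iff]

theorem map_mulVec_complexVec (M : Matrix (Fin n) (Fin m) ℝ) (V : Matrix (Fin m) (Fin 2) ℝ) :
    M.map Complex.ofReal *ᵥ complexVec V = complexVec (M * V) := by
  ext i
  apply Complex.ext <;>
    simp [complexVec, Matrix.mulVec, dotProduct, Matrix.mul_apply, Complex.re_sum, Complex.im_sum]

theorem smul_complexVec (z : ℂ) (V : Matrix (Fin m) (Fin 2) ℝ) :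
    z • complexVec V = complexVec (V * rot z) := by
  ext i
  apply Complex.ext <;>
    simp [complexVec, rot, Matrix.mul_apply, Fin.sum_univ_two] <;> ring

theorem complexVec_sub (V V' : Matrix (Fin m) (Fin 2) ℝ) :
    complexVec (V - V') = complexVec V - complexVec V' := by
  ext i
  apply Complex.ext <;> simp [complexVec]

theorem rot_mul (z w : ℂ) : rot (z * w) = rot z * rot w := by
  ext i j
  fin_cases i <;> fin_cases j <;> simp [rot, Matrix.mul_apply, Fin.sum_univ_two] <;> ring

theorem rot_one : rot 1 = 1 := by
  ext i j
  fin_cases i <;> fin_cases j <;> simp [rot]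

theorem rot_add (z w : ℂ) : rot (z + w) = rot z + rot w := by
  ext i j
  fin_cases i <;> fin_cases j <;> simp [rot] ; ring

theorem rot_neg (z : ℂ) : rot (-z) = -rot z := by
  ext i j
  fin_cases i <;> fin_cases j <;> simp [rot]

theorem rot_sub (z w : ℂ) : rot (z - w) = rot z - rot w := by
  rw [sub_eq_add_neg, rot_add, rot_neg, sub_eq_add_neg]

/-- The only way the real part of an eigenvalue enters the trace identities below. -/
theorem rot_transpose_add (z : ℂ) : (rot z)ᵀ + rot z = (2 * z.re) • 1 := by
  ext i j
  fin_cases i <;> fin_cases j <;> simp [rot] <;> ring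

/-- The columns of `V` are the real and imaginary parts of an eigenvector. For symmetric real `P`
the Hermitian form $v^*Pv$ is then the trace of $V^\top PV$, so spectral arguments become real trace
computations. -/
theorem mem_spectrum_map_iff (F : Matrix (Fin m) (Fin m) ℝ) (z : ℂ) :
    z ∈ spectrum ℂ (F.map Complex.ofReal) ↔
      ∃ V : Matrix (Fin m) (Fin 2) ℝ, V ≠ 0 ∧ F * V = V * rot z := by
  rw [Matrix.mem_spectrum_iff_isRoot_charpoly, Polynomial.IsRoot.def, Matrix.eval_charpoly,
    ← Matrix.exists_mulVec_eq_zero_iff]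
  constructor
  · rintro ⟨v, hv, h⟩
    obtain ⟨V, rfl⟩ := complexVec_surjective v
    refine ⟨V, fun h0 => hv (complexVec_eq_zero.2 h0), complexVec_injective ?_⟩
    rw [Matrix.sub_mulVec, map_mulVec_complexVec, sub_eq_zero] at h
    rw [← h, ← smul_complexVec]
    simp
  · rintro ⟨V, hV, h⟩
    refine ⟨complexVec V, fun h0 => hV (complexVec_eq_zero.1 h0), ?_⟩
    rw [Matrix.sub_mulVec, map_mulVec_complexVec, h, ← smul_complexVec]
    simp

theorem isHurwitz_iff (F : Matrix (Fin m) (Fin m) ℝ) :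
    IsHurwitz F ↔ ∀ (z : ℂ) (V : Matrix (Fin m) (Fin 2) ℝ), 0 ≤ z.re → F * V = V * rot z → V = 0 := by
  constructor
  · intro h z V hz hV
    by_contra h0
    exact absurd (h z ((mem_spectrum_map_iff F z).2 ⟨V, h0, hV⟩)) (not_lt.2 hz)
  · intro h z hz
    obtain ⟨V, hV, hFV⟩ := (mem_spectrum_map_iff F z).1 hz
    by_contra hn
    exact hV (h z V (not_lt.1 hn) hFV)

end ComplexVectors

/-! ### Cayley transform and Sylvester equations -/

section Cayley

variable {m : ℕ}

theorem IsHurwitz.isUnit_one_sub {F : Matrix (Fin m) (Fin m) ℝ} (hF : IsHurwitz F) :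
    IsUnit (1 - F).det := by
  rw [isUnit_iff_ne_zero]
  intro h0
  obtain ⟨v, hv, h⟩ := Matrix.exists_mulVec_eq_zero_iff.2 h0
  have h1 := (isHurwitz_iff F).1 hF 1 (Matrix.of fun i _ => v i) (by simp) (by
    rw [rot_one, Matrix.mul_one]
    rw [Matrix.sub_mulVec, Matrix.one_mulVec, sub_eq_zero] at h
    ext i j
    have := congrFun h i
    simpa [Matrix.mul_apply, Matrix.mulVec, dotProduct] using this.symm)
  apply hv
  ext i
  exact congrFun (congrFun h1 i) 0

/-- The Cayley transform `(1 + F) (1 - F)⁻¹`. -/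
noncomputable def cayley (F : Matrix (Fin m) (Fin m) ℝ) : Matrix (Fin m) (Fin m) ℝ :=
  (1 + F) * (1 - F)⁻¹

theorem tendsto_pow_zero_of_spectralRadius_lt_one {A : Type*} [NormedRing A] [NormedAlgebra ℂ A]
    [CompleteSpace A] (a : A) (h : spectralRadius ℂ a < 1) :
    Tendsto (fun k : ℕ => a ^ k) atTop (𝓝 0) := by
  obtain ⟨r, hr, hr1⟩ := ENNReal.lt_iff_exists_nnreal_btwn.1 h
  have hev := (spectrum.pow_nnnorm_pow_one_div_tendsto_nhds_spectralRadius a).eventually_lt_const hr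
  have hr1' : r < 1 := by exact_mod_cast hr1
  have hpow : Tendsto (fun k : ℕ => (r : ℝ) ^ k) atTop (𝓝 0) :=
    tendsto_pow_atTop_nhds_zero_of_lt_one r.2 (by exact_mod_cast hr1')
  refine squeeze_zero_norm' ?_ hpow
  filter_upwards [hev, eventually_gt_atTop 0] with k hk hk0
  have hk' : (0 : ℝ) < k := by exact_mod_cast hk0
  have h2 := ENNReal.rpow_lt_rpow hk hk'
  rw [← ENNReal.rpow_mul, one_div, inv_mul_cancel₀ hk'.ne', ENNReal.rpow_one,
    ENNReal.rpow_natCast] at h2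
  have h3 : ‖a ^ k‖₊ < r ^ k := by exact_mod_cast h2
  exact_mod_cast h3.le

/-- Pulled back by $(1-F)^{-1}$, an eigenvector for $z$ becomes one of $F$ for $(z-1)/(z+1)$, whose
real part is nonnegative when $|z|\ge1$. The value $z=-1$ is excluded separately, as it would give
$-2U=0$. -/
theorem IsHurwitz.spectrum_cayley_lt {F : Matrix (Fin m) (Fin m) ℝ} (hF : IsHurwitz F) {z : ℂ}
    (hz : z ∈ spectrum ℂ ((cayley F).map Complex.ofReal)) : ‖z‖ < 1 := by
  obtain ⟨V, hV, hGV⟩ := (mem_spectrum_map_iff _ z).1 hz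
  by_contra hn
  rw [not_lt] at hn
  have hu := hF.isUnit_one_sub
  set U := (1 - F)⁻¹ * V with hU
  have hVU : V = (1 - F) * U := by
    rw [hU, ← Matrix.mul_assoc, Matrix.mul_nonsing_inv _ hu, Matrix.one_mul]
  have h1 : (1 + F) * U = (1 - F) * U * rot z := by
    rw [← hVU, hU, ← hGV, cayley, Matrix.mul_assoc]
  have h2 : F * U * rot (z + 1) = U * rot (z - 1) := by
    rw [rot_add, rot_sub, rot_one]
    simp only [Matrix.add_mul, Matrix.sub_mul, Matrix.mul_add, Matrix.mul_sub, Matrix.one_mul,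
      Matrix.mul_one] at h1 ⊢
    have h3 : F * U + F * U * rot z = U * rot z - U := by
      rw [eq_sub_iff_add_eq, ← sub_eq_zero]
      rw [← sub_eq_zero] at h1
      rw [← h1]; abel
    rw [← h3]; abel
  have hU0 : U = 0 := by
    by_cases hz1 : z + 1 = 0
    · have h4 : z - 1 = -(1 + 1) := by linear_combination hz1
      have h0 : rot 0 = 0 := by simpa using rot_sub 0 0
      rw [hz1, h4, rot_neg, rot_add, rot_one, h0, Matrix.mul_zero] at h2
      have h5 : (2 : ℝ) • U = 0 := by
        rw [two_smul, ← neg_eq_zero, ← Matrix.mul_one U, ← Matrix.mul_add, ← Matrix.mul_neg]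
        exact h2.symm
      simpa using h5
    · refine (isHurwitz_iff F).1 hF ((z - 1) / (z + 1)) U ?_ ?_
      · rw [Complex.div_re, ← add_div]
        apply div_nonneg _ (Complex.normSq_nonneg _)
        have h6 : 1 ≤ Complex.normSq z := by
          rw [Complex.normSq_eq_norm_sq]; nlinarith
        rw [Complex.normSq_apply] at h6
        simp
        nlinarith
      · calc F * U = F * U * rot (z + 1) * rot (z + 1)⁻¹ := by
              rw [Matrix.mul_assoc, ← rot_mul, mul_inv_cancel₀ hz1, rot_one, Matrix.mul_one]
          _ = _ := by rw [h2, Matrix.mul_assoc, ← rot_mul, div_eq_mul_inv]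
  exact hV (by rw [hVU, hU0, Matrix.mul_zero])

theorem IsHurwitz.tendsto_cayley_pow {F : Matrix (Fin m) (Fin m) ℝ} (hF : IsHurwitz F) :
    Tendsto (fun k : ℕ => cayley F ^ k) atTop (𝓝 0) := by
  rcases isEmpty_or_nonempty (Fin m) with hm | hm
  · exact tendsto_const_nhds.congr fun k => Subsingleton.elim _ _
  have h1 : Tendsto (fun k : ℕ => ((cayley F).map Complex.ofReal) ^ k) atTop (𝓝 0) := by
    apply tendsto_pow_zero_of_spectralRadius_lt_one
    exact_mod_cast spectrum.spectralRadius_lt_of_forall_lt ((cayley F).map Complex.ofReal)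
      (r := 1) fun z hz => by exact_mod_cast hF.spectrum_cayley_lt hz
  have h2 : ∀ k : ℕ, cayley F ^ k = (((cayley F).map Complex.ofReal) ^ k).map Complex.re := by
    intro k
    have : ((cayley F).map Complex.ofReal) ^ k = (cayley F ^ k).map Complex.ofReal :=
      (map_pow (Complex.ofRealHom.mapMatrix (m := Fin m)) (cayley F) k).symm
    rw [this]
    ext i j
    simp
  simp_rw [h2]
  have h3 : Continuous fun M : Matrix (Fin m) (Fin m) ℂ => M.map Complex.re :=
    continuous_id.matrix_map Complex.continuous_re
  have h4 := (h3.tendsto 0).comp h1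
  have h5 : (0 : Matrix (Fin m) (Fin m) ℂ).map Complex.re = 0 := by ext; simp
  rw [h5] at h4
  exact h4

/-- The Cayley transform turns a Sylvester equation into a Stein equation. -/
theorem stein_of_sylvester {F₁ F₂ X Z : Matrix (Fin m) (Fin m) ℝ} (h₁ : IsHurwitz F₁)
    (h₂ : IsHurwitz F₂) (h : F₁ᵀ * X + X * F₂ = -Z) :
    X = (cayley F₁)ᵀ * X * cayley F₂ + (2 : ℝ) • (((1 - F₁)⁻¹)ᵀ * Z * (1 - F₂)⁻¹) := by
  have hu₁ := h₁.isUnit_one_sub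
  have hu₂ := h₂.isUnit_one_sub
  have e1 : ((1 - F₁)⁻¹)ᵀ * (1 - F₁)ᵀ = 1 := by
    rw [← Matrix.transpose_mul, Matrix.mul_nonsing_inv _ hu₁, Matrix.transpose_one]
  have key : (1 - F₁)ᵀ * X * (1 - F₂) = (1 + F₁)ᵀ * X * (1 + F₂) + (2 : ℝ) • Z := by
    have hZ : Z = -(F₁ᵀ * X + X * F₂) := by rw [h, neg_neg]
    rw [hZ, two_smul]
    simp only [Matrix.transpose_add, Matrix.transpose_sub, Matrix.transpose_one]
    noncomm_ring
  calc X = (((1 - F₁)⁻¹)ᵀ * (1 - F₁)ᵀ) * X * ((1 - F₂) * (1 - F₂)⁻¹) := by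
        rw [e1, Matrix.mul_nonsing_inv _ hu₂, Matrix.one_mul, Matrix.mul_one]
    _ = ((1 - F₁)⁻¹)ᵀ * ((1 - F₁)ᵀ * X * (1 - F₂)) * (1 - F₂)⁻¹ := by
        simp only [Matrix.mul_assoc]
    _ = _ := by
        rw [key, cayley, cayley, Matrix.transpose_mul]
        simp only [Matrix.mul_add, Matrix.add_mul, Matrix.mul_assoc, Matrix.mul_smul,
          Matrix.smul_mul]

/-- Iterating the homogeneous Stein equation gives $X=(G_1^k)^\top XG_2^k$ with $G_i$ the Cayley
transforms, and their powers tend to zero. -/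
theorem sylvester_injective {F₁ F₂ X : Matrix (Fin m) (Fin m) ℝ} (h₁ : IsHurwitz F₁)
    (h₂ : IsHurwitz F₂) (h : F₁ᵀ * X + X * F₂ = 0) : X = 0 := by
  have h0 := stein_of_sylvester (Z := 0) h₁ h₂ (by simpa using h)
  simp only [Matrix.mul_zero, Matrix.zero_mul, smul_zero, add_zero] at h0
  have hk : ∀ k : ℕ, X = (cayley F₁ ^ k)ᵀ * X * cayley F₂ ^ k := by
    intro k
    induction k with
    | zero => simp
    | succ k ih =>
      rw [pow_succ, pow_succ, Matrix.transpose_mul]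
      calc X = (cayley F₁)ᵀ * X * cayley F₂ := h0
        _ = (cayley F₁)ᵀ * ((cayley F₁ ^ k)ᵀ * X * cayley F₂ ^ k) * cayley F₂ := by rw [← ih]
        _ = _ := by simp only [Matrix.mul_assoc]
  have ht : Tendsto (fun k : ℕ => (cayley F₁ ^ k)ᵀ * X * cayley F₂ ^ k) atTop (𝓝 0) := by
    have h3 : Tendsto (fun k : ℕ => (cayley F₁ ^ k)ᵀ) atTop (𝓝 0) := by
      have := (continuous_id.matrix_transpose.tendsto
        (0 : Matrix (Fin m) (Fin m) ℝ)).comp h₁.tendsto_cayley_pow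
      rwa [id, Matrix.transpose_zero] at this
    simpa using (h3.mul_const X).mul h₂.tendsto_cayley_pow
  exact tendsto_nhds_unique (tendsto_const_nhds.congr hk) ht

end Cayley

/-! ### Positive semidefinite matrices, traces and norms -/

section PosSemidef

variable {m k : ℕ}

theorem transpose_eq_of_isHermitian {M : Matrix (Fin m) (Fin m) ℝ} (h : M.IsHermitian) :
    Mᵀ = M := by
  rw [← Matrix.conjTranspose_eq_transpose_of_trivial]; exact h

theorem isHermitian_of_transpose_eq {M : Matrix (Fin m) (Fin m) ℝ} (h : Mᵀ = M) :
    M.IsHermitian := by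
  rw [← Matrix.conjTranspose_eq_transpose_of_trivial] at h; exact h

theorem Matrix.PosSemidef.transpose_eq {M : Matrix (Fin m) (Fin m) ℝ} (h : M.PosSemidef) :
    Mᵀ = M := transpose_eq_of_isHermitian h.1

theorem Matrix.PosDef.transpose_eq {M : Matrix (Fin m) (Fin m) ℝ} (h : M.PosDef) :
    Mᵀ = M := transpose_eq_of_isHermitian h.1

theorem posSemidef_real_iff {M : Matrix (Fin m) (Fin m) ℝ} :
    M.PosSemidef ↔ Mᵀ = M ∧ ∀ x, 0 ≤ x ⬝ᵥ M *ᵥ x := by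
  rw [Matrix.posSemidef_iff_dotProduct_mulVec]
  exact ⟨fun h => ⟨transpose_eq_of_isHermitian h.1, h.2⟩,
    fun h => ⟨isHermitian_of_transpose_eq h.1, h.2⟩⟩

theorem Matrix.PosSemidef.transpose_mul_mul {M : Matrix (Fin m) (Fin m) ℝ} (h : M.PosSemidef)
    (V : Matrix (Fin m) (Fin k) ℝ) : (Vᵀ * M * V).PosSemidef := by
  have := h.conjTranspose_mul_mul_same V
  rwa [Matrix.conjTranspose_eq_transpose_of_trivial] at this

theorem posSemidef_transpose_mul_self (V : Matrix (Fin m) (Fin k) ℝ) : (Vᵀ * V).PosSemidef := by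
  have := Matrix.posSemidef_conjTranspose_mul_self V
  rwa [Matrix.conjTranspose_eq_transpose_of_trivial] at this

theorem trace_transpose_mul_self_nonneg (V : Matrix (Fin m) (Fin k) ℝ) : 0 ≤ (Vᵀ * V).trace :=
  (posSemidef_transpose_mul_self V).trace_nonneg

theorem trace_transpose_mul_self_eq_zero {V : Matrix (Fin m) (Fin k) ℝ} :
    (Vᵀ * V).trace = 0 ↔ V = 0 := by
  have := Matrix.trace_conjTranspose_mul_self_eq_zero_iff (A := V)
  rwa [Matrix.conjTranspose_eq_transpose_of_trivial] at this

theorem Matrix.PosSemidef.trace_quad_nonneg {M : Matrix (Fin m) (Fin m) ℝ} (h : M.PosSemidef)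
    (V : Matrix (Fin m) (Fin k) ℝ) : 0 ≤ (Vᵀ * M * V).trace :=
  (h.transpose_mul_mul V).trace_nonneg

theorem Matrix.PosSemidef.mul_eq_zero_of_trace_quad {M : Matrix (Fin m) (Fin m) ℝ}
    (h : M.PosSemidef) {V : Matrix (Fin m) (Fin k) ℝ} (h0 : (Vᵀ * M * V).trace = 0) :
    M * V = 0 := by
  have h1 := (h.transpose_mul_mul V).trace_eq_zero_iff.1 h0
  ext i j
  have h2 : star (fun i => V i j) ⬝ᵥ M *ᵥ (fun i => V i j) = 0 := by
    have := congrFun (congrFun h1 j) j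
    rw [Matrix.mul_assoc] at this
    simpa [Matrix.mul_apply, Matrix.mulVec, dotProduct] using this
  simpa [Matrix.mul_apply, Matrix.mulVec, dotProduct] using
    congrFun ((h.dotProduct_mulVec_zero_iff _).1 h2) i

theorem Matrix.PosDef.eq_zero_of_mul_eq_zero {M : Matrix (Fin m) (Fin m) ℝ} (h : M.PosDef)
    {V : Matrix (Fin m) (Fin k) ℝ} (h0 : M * V = 0) : V = 0 := by
  have hu := (Matrix.isUnit_iff_isUnit_det M).1 h.isUnit
  rw [← Matrix.one_mul V, ← Matrix.nonsing_inv_mul _ hu, Matrix.mul_assoc, h0, Matrix.mul_zero]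

theorem Matrix.PosDef.trace_quad_pos {M : Matrix (Fin m) (Fin m) ℝ} (h : M.PosDef)
    {V : Matrix (Fin m) (Fin k) ℝ} (hV : V ≠ 0) : 0 < (Vᵀ * M * V).trace :=
  lt_of_le_of_ne (h.posSemidef.trace_quad_nonneg V) fun h0 =>
    hV (h.eq_zero_of_mul_eq_zero (h.posSemidef.mul_eq_zero_of_trace_quad h0.symm))

theorem isClosed_posSemidef : IsClosed {M : Matrix (Fin m) (Fin m) ℝ | M.PosSemidef} := by
  simp only [posSemidef_real_iff, Set.ofPred_and, Set.ofPred_forall]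
  refine IsClosed.inter (isClosed_eq (by fun_prop) (by fun_prop)) (isClosed_iInter fun x => ?_)
  exact isClosed_le (by fun_prop) (by fun_prop)

theorem dotProduct_mulVec_le (M : Matrix (Fin m) (Fin m) ℝ) (x : Fin m → ℝ) :
    x ⬝ᵥ M *ᵥ x ≤ ‖M‖ * (x ⬝ᵥ x) := by
  have h1 := Matrix.inner_toEuclideanCLM M (WithLp.toLp 2 x) (WithLp.toLp 2 x)
  have h2 : x ⬝ᵥ x = ‖WithLp.toLp 2 x‖ ^ 2 := by
    rw [EuclideanSpace.real_norm_sq_eq]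
    simp [dotProduct, pow_two]
  change _ = x ⬝ᵥ M *ᵥ x at h1
  rw [← h1, h2]
  calc _ ≤ ‖WithLp.toLp 2 x‖ * ‖Matrix.toEuclideanCLM (𝕜 := ℝ) M (WithLp.toLp 2 x)‖ :=
        real_inner_le_norm _ _
    _ ≤ ‖WithLp.toLp 2 x‖ * (‖M‖ * ‖WithLp.toLp 2 x‖) := by
        gcongr
        exact (Matrix.toEuclideanCLM (𝕜 := ℝ) M).le_opNorm _
    _ = _ := by ring

theorem posSemidef_smul_one_sub {M : Matrix (Fin m) (Fin m) ℝ} (hM : Mᵀ = M) {c : ℝ}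
    (hc : ‖M‖ ≤ c) : (c • 1 - M).PosSemidef := by
  rw [posSemidef_real_iff]
  refine ⟨by simp [hM], fun x => ?_⟩
  have h := dotProduct_mulVec_le M x
  have h0 : 0 ≤ x ⬝ᵥ x := dotProduct_self_star_nonneg x
  simp only [Matrix.sub_mulVec, Matrix.smul_mulVec, Matrix.one_mulVec, dotProduct_sub,
    dotProduct_smul, smul_eq_mul]
  nlinarith

theorem Matrix.PosDef.exists_smul_one_le {M : Matrix (Fin m) (Fin m) ℝ} (hM : M.PosDef) :
    ∃ c : ℝ, 0 < c ∧ (M - c • 1).PosSemidef := by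
  have hu := (Matrix.isUnit_iff_isUnit_det M).1 hM.isUnit
  set N := M⁻¹ with hN
  have hNP : N.PosDef := hM.inv
  have hν : 0 < ‖N‖ + 1 := by positivity
  set s := (‖N‖ + 1)⁻¹ with hs
  have hs0 : 0 < s := inv_pos.2 hν
  refine ⟨s, hs0, ?_⟩
  have h1 : (M - s • 1)ᵀ = M - s • 1 := by simp [hM.transpose_eq]
  have h2 := hNP.posSemidef.transpose_mul_mul (M - s • 1)
  have h3 := (posSemidef_smul_one_sub hNP.transpose_eq (le_add_of_nonneg_right zero_le_one)).smul
    (sq_nonneg s)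
  have hMN : M * N = 1 := Matrix.mul_nonsing_inv _ hu
  have hNM : N * M = 1 := Matrix.nonsing_inv_mul _ hu
  -- Since $N=M^{-1}$ and $s(\|N\|+1)=1$, both summands are nonnegative: a congruence of $N$ and a
  -- multiple of $(\|N\|+1)-N$.
  have h4 : M - s • 1 = (M - s • 1)ᵀ * N * (M - s • 1) + s ^ 2 • ((‖N‖ + 1) • 1 - N) := by
    rw [h1]
    simp only [Matrix.sub_mul, Matrix.mul_sub, hMN, Matrix.smul_mul, Matrix.mul_smul,
      Matrix.one_mul, Matrix.mul_one, hNM, smul_sub, smul_smul]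
    have h5 : s ^ 2 * (‖N‖ + 1) = s := by
      rw [hs]; field_simp
    rw [h5, pow_two]
    abel
  rw [h4]
  exact h2.add h3

theorem trace_quad_mono {M N : Matrix (Fin m) (Fin m) ℝ} (h : (N - M).PosSemidef)
    (V : Matrix (Fin m) (Fin k) ℝ) : (Vᵀ * M * V).trace ≤ (Vᵀ * N * V).trace := by
  have := h.trace_quad_nonneg V
  rw [Matrix.mul_sub, Matrix.sub_mul, Matrix.trace_sub] at this
  linarith

theorem Matrix.PosDef.exists_le_trace_quad {M : Matrix (Fin m) (Fin m) ℝ} (hM : M.PosDef) :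
    ∃ c : ℝ, 0 < c ∧ ∀ (k : ℕ) (V : Matrix (Fin m) (Fin k) ℝ),
      c * (Vᵀ * V).trace ≤ (Vᵀ * M * V).trace := by
  obtain ⟨c, hc, h⟩ := hM.exists_smul_one_le
  refine ⟨c, hc, fun k V => ?_⟩
  have := trace_quad_mono h V
  simpa using this

theorem trace_quad_le (M : Matrix (Fin m) (Fin m) ℝ) (hM : Mᵀ = M)
    (V : Matrix (Fin m) (Fin k) ℝ) : (Vᵀ * M * V).trace ≤ ‖M‖ * (Vᵀ * V).trace := by
  have := trace_quad_mono (posSemidef_smul_one_sub hM le_rfl) V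
  simpa using this

theorem Matrix.PosSemidef.exists_eq_transpose_mul_self {M : Matrix (Fin m) (Fin m) ℝ}
    (hM : M.PosSemidef) : ∃ B : Matrix (Fin m) (Fin m) ℝ, M = Bᵀ * B := by
  open scoped MatrixOrder in
  obtain ⟨B, hB⟩ := (CStarAlgebra.nonneg_iff_eq_star_mul_self (a := M)).1 hM.nonneg
  refine ⟨B, ?_⟩
  rw [hB, Matrix.star_eq_conjTranspose, Matrix.conjTranspose_eq_transpose_of_trivial]

/-- The trace of a product of positive semidefinite matrices is nonnegative. -/
theorem Matrix.PosSemidef.trace_mul_nonneg {M N : Matrix (Fin m) (Fin m) ℝ} (hM : M.PosSemidef)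
    (hN : N.PosSemidef) : 0 ≤ (M * N).trace := by
  obtain ⟨B, rfl⟩ := hN.exists_eq_transpose_mul_self
  have := hM.trace_quad_nonneg Bᵀ
  rwa [Matrix.transpose_transpose, Matrix.trace_mul_comm, ← Matrix.mul_assoc,
    Matrix.trace_mul_comm] at this

theorem norm_sq_le_trace (V : Matrix (Fin m) (Fin k) ℝ) : ‖V‖ ^ 2 ≤ (Vᵀ * V).trace := by
  have ht : (Vᵀ * V).trace = ∑ i, ∑ j, V i j ^ 2 := by
    rw [Finset.sum_comm]
    simp [Matrix.trace, Matrix.mul_apply, pow_two]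
  have h0 := trace_transpose_mul_self_nonneg V
  have : ‖V‖ ≤ √((Vᵀ * V).trace) := by
    rw [Matrix.l2_opNorm_def]
    refine ContinuousLinearMap.opNorm_le_bound _ (Real.sqrt_nonneg _) fun x => ?_
    refine le_of_sq_le_sq ?_ (by positivity)
    rw [mul_pow, Real.sq_sqrt h0, ht, Finset.sum_mul, EuclideanSpace.real_norm_sq_eq,
      EuclideanSpace.real_norm_sq_eq]
    refine Finset.sum_le_sum fun i _ => ?_
    exact Finset.sum_mul_sq_le_sq_mul_sq Finset.univ (fun j => V i j) (fun j => x j)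
  calc ‖V‖ ^ 2 ≤ √((Vᵀ * V).trace) ^ 2 := by gcongr
    _ = _ := Real.sq_sqrt h0

theorem Matrix.PosSemidef.norm_le_trace {M : Matrix (Fin m) (Fin m) ℝ} (hM : M.PosSemidef) :
    ‖M‖ ≤ M.trace := by
  obtain ⟨B, rfl⟩ := hM.exists_eq_transpose_mul_self
  have h := Matrix.l2_opNorm_conjTranspose_mul_self B
  rw [Matrix.conjTranspose_eq_transpose_of_trivial] at h
  rw [h, ← pow_two]
  exact norm_sq_le_trace B

theorem norm_transpose (V : Matrix (Fin m) (Fin k) ℝ) : ‖Vᵀ‖ = ‖V‖ := by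
  rw [← Matrix.conjTranspose_eq_transpose_of_trivial, Matrix.l2_opNorm_conjTranspose]

theorem abs_trace_le (M : Matrix (Fin m) (Fin m) ℝ) : |M.trace| ≤ m * ‖M‖ := by
  have h : ∀ i, |M i i| ≤ ‖M‖ := by
    intro i
    have h1 := dotProduct_mulVec_le M (Pi.single i 1)
    have h2 := dotProduct_mulVec_le (-M) (Pi.single i 1)
    simp at h1 h2
    exact abs_le.2 ⟨by linarith, h1⟩
  calc |M.trace| ≤ ∑ i, |M i i| := Finset.abs_sum_le_sum_abs _ _
    _ ≤ ∑ _i : Fin m, ‖M‖ := Finset.sum_le_sum fun i _ => h i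
    _ = _ := by simp

end PosSemidef

/-! ### Lyapunov equations and Hurwitz matrices -/

section Lyapunov

variable {m : ℕ}

theorem exists_lyapunov {F : Matrix (Fin m) (Fin m) ℝ} (hF : IsHurwitz F)
    (Z : Matrix (Fin m) (Fin m) ℝ) : ∃ X, Fᵀ * X + X * F = Z := by
  let T : Matrix (Fin m) (Fin m) ℝ →ₗ[ℝ] Matrix (Fin m) (Fin m) ℝ :=
    LinearMap.mulLeft ℝ Fᵀ + LinearMap.mulRight ℝ F
  have hT : Function.Injective T := by
    rw [← LinearMap.ker_eq_bot, LinearMap.ker_eq_bot']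
    exact fun X hX => sylvester_injective hF hF hX
  exact LinearMap.injective_iff_surjective.1 hT Z

/-- Symmetry follows from uniqueness. By the Stein form, $X-(G^k)^\top XG^k$ is a sum of congruences
of $Z$, with $G$ the Cayley transform, and it tends to $X$. -/
theorem lyapunov_posSemidef {F X Z : Matrix (Fin m) (Fin m) ℝ} (hF : IsHurwitz F)
    (hZ : Z.PosSemidef) (h : Fᵀ * X + X * F = -Z) : X.PosSemidef := by
  have hX : Xᵀ = X := by
    rw [← sub_eq_zero]
    refine sylvester_injective hF hF ?_
    have h' := congrArg Matrix.transpose h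
    simp only [Matrix.transpose_add, Matrix.transpose_mul, Matrix.transpose_transpose,
      Matrix.transpose_neg, hZ.transpose_eq] at h'
    rw [Matrix.mul_sub, Matrix.sub_mul]
    calc _ = (Xᵀ * F + Fᵀ * Xᵀ) - (Fᵀ * X + X * F) := by abel
      _ = 0 := by rw [h, h', sub_self]
  have h0 := stein_of_sylvester hF hF h
  have hZ' : ((2 : ℝ) • (((1 - F)⁻¹)ᵀ * Z * (1 - F)⁻¹)).PosSemidef :=
    (hZ.transpose_mul_mul _).smul (by norm_num)
  have hk : ∀ k : ℕ, (X - (cayley F ^ k)ᵀ * X * cayley F ^ k).PosSemidef := by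
    intro k
    induction k with
    | zero => simpa using Matrix.PosSemidef.zero
    | succ k ih =>
      have h1 := (ih.transpose_mul_mul (cayley F)).add hZ'
      convert h1 using 1
      rw [pow_succ, Matrix.transpose_mul, Matrix.mul_sub, Matrix.sub_mul, sub_add_eq_add_sub, ← h0]
      simp only [Matrix.mul_assoc]
  have h3 : Tendsto (fun k : ℕ => (cayley F ^ k)ᵀ) atTop (𝓝 0) := by
    have := (continuous_id.matrix_transpose.tendsto
      (0 : Matrix (Fin m) (Fin m) ℝ)).comp hF.tendsto_cayley_pow
    rwa [id, Matrix.transpose_zero] at this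
  have h4 : Tendsto (fun k : ℕ => X - (cayley F ^ k)ᵀ * X * cayley F ^ k) atTop (𝓝 X) := by
    simpa using ((h3.mul_const X).mul hF.tendsto_cayley_pow).const_sub X
  exact isClosed_posSemidef.mem_of_tendsto h4 (Eventually.of_forall hk)

theorem lyapunov_posDef {F X Z : Matrix (Fin m) (Fin m) ℝ} (hF : IsHurwitz F)
    (hZ : Z.PosDef) (h : Fᵀ * X + X * F = -Z) : X.PosDef := by
  have hX := lyapunov_posSemidef hF hZ.posSemidef h
  refine Matrix.PosDef.of_dotProduct_mulVec_pos hX.1 fun x hx => ?_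
  refine lt_of_le_of_ne (hX.dotProduct_mulVec_nonneg x) fun h0 => ?_
  have h1 := (hX.dotProduct_mulVec_zero_iff x).1 h0.symm
  have h2 := hZ.dotProduct_mulVec_pos hx
  have h3 : Z = -(Fᵀ * X + X * F) := by rw [h, neg_neg]
  have h4 : x ᵥ* X = 0 := by rw [← Matrix.mulVec_transpose, hX.transpose_eq, h1]
  rw [h3, Matrix.neg_mulVec, Matrix.add_mulVec, ← Matrix.mulVec_mulVec, h1, ← Matrix.mulVec_mulVec]
    at h2
  simp [Matrix.dotProduct_mulVec, ← Matrix.vecMul_vecMul, h4] at h2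

theorem trace_lyapunov_of_eigen {F X : Matrix (Fin m) (Fin m) ℝ} {V : Matrix (Fin m) (Fin 2) ℝ}
    {z : ℂ} (hV : F * V = V * rot z) :
    (Vᵀ * (Fᵀ * X + X * F) * V).trace = 2 * z.re * (Vᵀ * X * V).trace := by
  have hV' : Vᵀ * Fᵀ = (rot z)ᵀ * Vᵀ := by rw [← Matrix.transpose_mul, hV, Matrix.transpose_mul]
  calc (Vᵀ * (Fᵀ * X + X * F) * V).trace
      = ((Vᵀ * Fᵀ) * (X * V) + Vᵀ * X * (F * V)).trace := by
        simp only [Matrix.mul_add, Matrix.add_mul, Matrix.mul_assoc]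
    _ = ((rot z)ᵀ * (Vᵀ * X * V) + (Vᵀ * X * V) * rot z).trace := by
        rw [hV, hV']; simp only [Matrix.mul_assoc]
    _ = (((rot z)ᵀ + rot z) * (Vᵀ * X * V)).trace := by
        rw [Matrix.trace_add, Matrix.trace_mul_comm _ (rot z), ← Matrix.trace_add, Matrix.add_mul]
    _ = _ := by rw [rot_transpose_add]; simp

theorem isHurwitz_of_lyapunov {F X : Matrix (Fin m) (Fin m) ℝ} (hX : X.PosSemidef)
    (h : (-(Fᵀ * X + X * F)).PosDef) : IsHurwitz F := by
  rw [isHurwitz_iff]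
  intro z V hz hV
  by_contra hne
  have h1 := h.trace_quad_pos hne
  rw [Matrix.mul_neg, Matrix.neg_mul, Matrix.trace_neg, trace_lyapunov_of_eigen hV] at h1
  have h2 := mul_nonneg (mul_nonneg zero_le_two hz) (hX.trace_quad_nonneg V)
  linarith

/-- The solution $X$ of $F^\top X+XF=-1$ remains a Lyapunov certificate for every matrix close to
$F$. -/
theorem isOpen_isHurwitz : IsOpen {F : Matrix (Fin m) (Fin m) ℝ | IsHurwitz F} := by
  rw [isOpen_iff_mem_nhds]
  intro F hF
  obtain ⟨X, hX⟩ := exists_lyapunov hF (-1)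
  have hXP := lyapunov_posDef hF Matrix.PosDef.one hX
  have hc : Continuous fun F' : Matrix (Fin m) (Fin m) ℝ => ‖F'ᵀ * X + X * F' + 1‖ := by fun_prop
  have hnear : ∀ᶠ F' in 𝓝 F, ‖F'ᵀ * X + X * F' + 1‖ < 1 := by
    refine (hc.tendsto F).eventually_lt_const ?_
    rw [hX]; simp
  filter_upwards [hnear] with F' hF'
  refine isHurwitz_of_lyapunov hXP.posSemidef ?_
  set N := F'ᵀ * X + X * F' + 1 with hN
  have hNt : Nᵀ = N := by
    simp [hN, hXP.transpose_eq, add_comm]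
  have h1 := posSemidef_smul_one_sub hNt le_rfl
  have h2 : ((1 - ‖N‖) • (1 : Matrix (Fin m) (Fin m) ℝ)).PosDef :=
    Matrix.PosDef.one.smul (by linarith)
  convert Matrix.PosDef.posSemidef_add h1 h2 using 1
  rw [sub_smul, one_smul, hN]
  abel

theorem pow_card_le_norm_prod {x : ℝ} (hx : 0 ≤ x) (z : ℂ) (hz : z.re = x) (s : Multiset ℂ)
    (hs : ∀ r ∈ s, r.re ≤ 0) : x ^ s.card ≤ ‖(s.map fun r => z - r).prod‖ := by
  induction s using Multiset.induction_on with
  | empty => simp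
  | cons a s ih =>
    simp only [Multiset.card_cons, Multiset.map_cons, Multiset.prod_cons, norm_mul, pow_succ']
    refine mul_le_mul ?_ (ih fun r hr => hs r (Multiset.mem_cons_of_mem hr)) (by positivity)
      (norm_nonneg _)
    have h1 := hs a (Multiset.mem_cons_self a s)
    have h2 := Complex.re_le_norm (z - a)
    simp only [Complex.sub_re] at h2
    linarith

/-- Every factor of $\det(z-F)=\prod(z-\lambda)$ has modulus at least $\operatorname{Re}z$. The
bound does not involve $F$ and so survives limits. -/
theorem IsHurwitz.pow_le_norm_det {F : Matrix (Fin m) (Fin m) ℝ} (hF : IsHurwitz F) {z : ℂ}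
    (hz : 0 ≤ z.re) : z.re ^ m ≤ ‖(Matrix.scalar (Fin m) z - F.map Complex.ofReal).det‖ := by
  rw [← Matrix.eval_charpoly,
    (IsAlgClosed.splits _).eval_eq_prod_roots_of_monic (Matrix.charpoly_monic _)]
  have hcard : (F.map Complex.ofReal).charpoly.roots.card = m := by
    rw [IsAlgClosed.card_roots_eq_natDegree, Matrix.charpoly_natDegree_eq_dim, Fintype.card_fin]
  conv_lhs => rw [← hcard]
  refine pow_card_le_norm_prod hz z rfl _ fun r hr => (hF r ?_).le
  rw [Matrix.mem_spectrum_iff_isRoot_charpoly]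
  exact (Polynomial.mem_roots'.1 hr).2

/-- A limit of Hurwitz matrices has no eigenvalue with positive real part. -/
theorem eq_zero_of_tendsto_isHurwitz {ι : Type*} {l : Filter ι} [l.NeBot]
    {f : ι → Matrix (Fin m) (Fin m) ℝ} {F : Matrix (Fin m) (Fin m) ℝ} (hf : Tendsto f l (𝓝 F))
    (hH : ∀ᶠ i in l, IsHurwitz (f i)) {z : ℂ} (hz : 0 < z.re) {V : Matrix (Fin m) (Fin 2) ℝ}
    (hV : F * V = V * rot z) : V = 0 := by
  by_contra hne
  have hs := (mem_spectrum_map_iff F z).2 ⟨V, hne, hV⟩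
  rw [Matrix.mem_spectrum_iff_isRoot_charpoly, Polynomial.IsRoot.def, Matrix.eval_charpoly] at hs
  have hc : Continuous fun M : Matrix (Fin m) (Fin m) ℝ =>
      ‖(Matrix.scalar (Fin m) z - M.map Complex.ofReal).det‖ := by
    refine (Continuous.matrix_det ?_).norm
    exact continuous_const.sub (continuous_id.matrix_map Complex.continuous_ofReal)
  have h1 : z.re ^ m ≤ ‖(Matrix.scalar (Fin m) z - F.map Complex.ofReal).det‖ :=
    ge_of_tendsto ((hc.tendsto F).comp hf) (hH.mono fun i hi => hi.pow_le_norm_det hz.le)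
  rw [hs, norm_zero] at h1
  exact absurd h1 (not_le.2 (pow_pos hz m))

end Lyapunov

/-! ### Riccati equations: uniqueness, comparison, perturbation -/

section Riccati

variable {m : ℕ}

/-- The Riccati expression `Aᵀ P + P A + Q + P W P`. -/
def ric (W A Q P : Matrix (Fin m) (Fin m) ℝ) : Matrix (Fin m) (Fin m) ℝ :=
  Aᵀ * P + P * A + Q + P * W * P

/-- `P` is a symmetric stabilizing solution of `Aᵀ P + P A + Q + P W P = 0`. -/
structure IsStab (W A Q P : Matrix (Fin m) (Fin m) ℝ) : Prop where
  symm : Pᵀ = P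
  eq : ric W A Q P = 0
  hurwitz : IsHurwitz (A + W * P)

variable {W A Q P : Matrix (Fin m) (Fin m) ℝ}

/-- Two different closed loops appear, one on each side, so the difference of two stabilizing
solutions solves a homogeneous Sylvester equation. -/
theorem ric_sub_ric (W A Q P₁ P₂ : Matrix (Fin m) (Fin m) ℝ) :
    ric W A Q P₁ - ric W A Q P₂ =
      (Aᵀ + P₁ * W) * (P₁ - P₂) + (P₁ - P₂) * (A + W * P₂) := by
  unfold ric; noncomm_ring

theorem transpose_closed (hW : Wᵀ = W) (hP : Pᵀ = P) : (A + W * P)ᵀ = Aᵀ + P * W := by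
  rw [Matrix.transpose_add, Matrix.transpose_mul, hW, hP]

theorem IsStab.unique (hW : Wᵀ = W) {P₁ P₂ : Matrix (Fin m) (Fin m) ℝ}
    (h₁ : IsStab W A Q P₁) (h₂ : IsStab W A Q P₂) : P₁ = P₂ := by
  have h := ric_sub_ric W A Q P₁ P₂
  rw [h₁.eq, h₂.eq, sub_zero, ← transpose_closed hW h₁.symm] at h
  exact sub_eq_zero.1 (sylvester_injective h₁.hurwitz h₂.hurwitz h.symm)

/-- Taylor expansion at `P₁`: a Lyapunov operator in the closed loop of `P₁`, and a remainder that
has a sign when `W` is nonnegative. -/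
theorem ric_sub_ric' (W A Q P₁ P₂ : Matrix (Fin m) (Fin m) ℝ) :
    ric W A Q P₂ - ric W A Q P₁ =
      (Aᵀ + P₁ * W) * (P₂ - P₁) + (P₂ - P₁) * (A + W * P₁) + (P₂ - P₁) * W * (P₂ - P₁) := by
  unfold ric; noncomm_ring

theorem posSemidef_mul_mul_self {X : Matrix (Fin m) (Fin m) ℝ} (hW : W.PosSemidef) (hX : Xᵀ = X) :
    (X * W * X).PosSemidef := by
  have := hW.transpose_mul_mul X
  rwa [hX] at this

/-- The stabilizing solution is the smallest supersolution. -/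
theorem IsStab.le_of_ric_nonpos (hW : W.PosSemidef) (h : IsStab W A Q P)
    {P' : Matrix (Fin m) (Fin m) ℝ} (hP' : P'ᵀ = P') (hr : (-ric W A Q P').PosSemidef) :
    (P' - P).PosSemidef := by
  have h1 := ric_sub_ric' W A Q P P'
  rw [h.eq, sub_zero, ← transpose_closed hW.transpose_eq h.symm] at h1
  refine lyapunov_posSemidef h.hurwitz
    (hr.add (posSemidef_mul_mul_self hW (X := P' - P) (by simp [hP', h.symm]))) ?_
  rw [h1]; abel

theorem IsStab.posSemidef (hW : W.PosSemidef) (hA : IsHurwitz A) (hQ : Q.PosSemidef)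
    (h : IsStab W A Q P) : P.PosSemidef := by
  refine lyapunov_posSemidef hA (hQ.add (posSemidef_mul_mul_self hW h.symm)) ?_
  have := h.eq
  rw [ric, add_assoc] at this
  exact eq_neg_of_add_eq_zero_left this

theorem ric_transpose (hW : Wᵀ = W) (hQ : Qᵀ = Q) (P : Matrix (Fin m) (Fin m) ℝ) :
    ric W A Q Pᵀ = (ric W A Q P)ᵀ := by
  simp only [ric, Matrix.transpose_add, Matrix.transpose_mul, Matrix.transpose_transpose, hW, hQ,
    Matrix.mul_assoc]
  abel

/-- Symmetry is automatic, since `Pᵀ` solves the same equation. This lets the perturbation argument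
run over all matrices rather than the symmetric ones. -/
theorem isStab_of_hurwitz (hW : Wᵀ = W) (hQ : Qᵀ = Q) (hr : ric W A Q P = 0)
    (h₁ : IsHurwitz (A + W * P)) : IsStab W A Q P := by
  refine ⟨?_, hr, h₁⟩
  have h := ric_sub_ric W A Q Pᵀ P
  rw [ric_transpose hW hQ, hr, Matrix.transpose_zero, sub_zero] at h
  have h3 : (A + W * P)ᵀ = Aᵀ + Pᵀ * W := by
    rw [Matrix.transpose_add, Matrix.transpose_mul, hW]
  rw [← h3] at h
  exact sub_eq_zero.1 (sylvester_injective h₁ h₁ h.symm)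

/-- Local solvability of the Riccati equation near a stabilizing solution. -/
theorem IsStab.eventually_exists (hW : Wᵀ = W) (h : IsStab W A Q P)
    {s : Set (Matrix (Fin m) (Fin m) ℝ)} (hs : s ∈ 𝓝 P) :
    ∀ᶠ p : Matrix (Fin m) (Fin m) ℝ × Matrix (Fin m) (Fin m) ℝ in 𝓝 (A, Q),
      p.2ᵀ = p.2 → ∃ P' ∈ s, IsStab W p.1 p.2 P' := by
  let E := Matrix (Fin m) (Fin m) ℝ
  let tr : E →L[ℝ] E := LinearMap.toContinuousLinearMap
    (Matrix.transposeLinearEquiv (Fin m) (Fin m) ℝ ℝ).toLinearMap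
  have htr : ∀ x : E, tr x = xᵀ := fun x => rfl
  let x₀ : E × E × E := (A, Q, P)
  let fA : E × E × E →L[ℝ] E := ContinuousLinearMap.fst ℝ E (E × E)
  let fQ : E × E × E →L[ℝ] E :=
    (ContinuousLinearMap.fst ℝ E E).comp (ContinuousLinearMap.snd ℝ E (E × E))
  let fP : E × E × E →L[ℝ] E :=
    (ContinuousLinearMap.snd ℝ E E).comp (ContinuousLinearMap.snd ℝ E (E × E))
  have dA : HasStrictFDerivAt (fun p : E × E × E => p.1) fA x₀ := fA.hasStrictFDerivAt
  have dQ : HasStrictFDerivAt (fun p : E × E × E => p.2.1) fQ x₀ := fQ.hasStrictFDerivAt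
  have dP : HasStrictFDerivAt (fun p : E × E × E => p.2.2) fP x₀ := fP.hasStrictFDerivAt
  have dT : HasStrictFDerivAt (fun p : E × E × E => tr p.1) (tr.comp fA) x₀ :=
    (tr.comp fA).hasStrictFDerivAt
  have dr := (((dT.mul' dP).add (dP.mul' dA)).add dQ).add ((dP.mul_const' W).mul' dP)
  -- The map $(A,Q,P)\mapsto(A,Q,\mathrm{ric})$ has a surjective derivative because the Lyapunov
  -- operator of the closed loop is onto. It therefore carries neighbourhoods to neighbourhoods, and
  -- a preimage of $(A',Q',0)$ is a solution for the perturbed data.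
  have dg := dA.prodMk (dQ.prodMk dr)
  have hmap := dg.map_nhds_eq_of_surj (by
    rw [LinearMap.range_eq_top]
    rintro ⟨a, q, z⟩
    obtain ⟨X, hX⟩ := exists_lyapunov h.hurwitz (z - q - aᵀ * P - P * a)
    refine ⟨(a, q, X), ?_⟩
    rw [transpose_closed hW h.symm] at hX
    refine Prod.ext rfl (Prod.ext rfl ?_)
    simp [x₀, htr, fA, fQ, fP]
    rw [eq_comm, ← sub_eq_zero] at hX
    rw [← sub_eq_zero, ← neg_eq_zero, ← hX]
    noncomm_ring)
  have hU : {p : E × E × E | p.2.2 ∈ s ∧ IsHurwitz (p.1 + W * p.2.2)} ∈ 𝓝 x₀ := by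
    have c1 : Continuous fun p : E × E × E => p.2.2 := by fun_prop
    have c2 : Continuous fun p : E × E × E => p.1 + W * p.2.2 := by fun_prop
    exact inter_mem ((c1.tendsto x₀) hs)
      ((c2.tendsto x₀) (isOpen_isHurwitz.mem_nhds h.hurwitz))
  have himg := image_mem_map (m := fun p : E × E × E => (p.1, p.2.1,
    tr p.1 * p.2.2 + p.2.2 * p.1 + p.2.1 + p.2.2 * W * p.2.2)) hU
  rw [show map (fun p : E × E × E => (p.1, p.2.1,
    tr p.1 * p.2.2 + p.2.2 * p.1 + p.2.1 + p.2.2 * W * p.2.2)) (𝓝 x₀) = _ from hmap] at himg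
  have hx : tr x₀.1 * x₀.2.2 + x₀.2.2 * x₀.1 + x₀.2.1 + x₀.2.2 * W * x₀.2.2 = 0 := h.eq
  change _ ∈ 𝓝 (x₀.1, x₀.2.1,
    tr x₀.1 * x₀.2.2 + x₀.2.2 * x₀.1 + x₀.2.1 + x₀.2.2 * W * x₀.2.2) at himg
  rw [hx] at himg
  have cp : Continuous fun p : E × E => ((p.1, p.2, 0) : E × E × E) := by fun_prop
  have ht := (cp.tendsto (A, Q)) himg
  filter_upwards [ht] with p hp hsym
  obtain ⟨⟨A', Q', P'⟩, ⟨h1, h2⟩, h4⟩ := hp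
  simp only [Prod.mk.injEq] at h4
  obtain ⟨rfl, rfl, h6⟩ := h4
  exact ⟨P', h1, isStab_of_hurwitz hW hsym h6 h2⟩

end Riccati

/-! ### From the frequency domain inequality to a stabilizing solution -/

section FrequencyDomain

variable {m : ℕ} {W A Q P : Matrix (Fin m) (Fin m) ℝ}

/-- The frequency domain inequality `Q < (s - A)* W⁻¹ (s - A)` on the imaginary axis. -/
def FreqPos (W A Q : Matrix (Fin m) (Fin m) ℝ) : Prop :=
  ∀ (z : ℂ) (V : Matrix (Fin m) (Fin 2) ℝ), z.re = 0 → V ≠ 0 →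
    (Vᵀ * Q * V).trace < ((V * rot z - A * V)ᵀ * W⁻¹ * (V * rot z - A * V)).trace

theorem trace_mul_rot_eq_zero (hP : Pᵀ = P) {z : ℂ} (hz : z.re = 0)
    (V : Matrix (Fin m) (Fin 2) ℝ) : (Vᵀ * P * V * rot z).trace = 0 := by
  have h1 : (Vᵀ * P * V * rot z).trace = ((rot z)ᵀ * (Vᵀ * P * V)).trace := by
    rw [← Matrix.trace_transpose]
    simp only [Matrix.transpose_mul, Matrix.transpose_transpose, hP, Matrix.mul_assoc]
  have h2 : ((rot z)ᵀ * (Vᵀ * P * V)).trace + (Vᵀ * P * V * rot z).trace = 0 := by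
    rw [Matrix.trace_mul_comm _ (rot z), ← Matrix.trace_add, ← Matrix.add_mul, rot_transpose_add,
      hz]
    simp
  linarith

theorem Matrix.PosDef.mul_inv_self {M : Matrix (Fin m) (Fin m) ℝ} (hM : M.PosDef) :
    M * M⁻¹ = 1 := Matrix.mul_nonsing_inv _ ((Matrix.isUnit_iff_isUnit_det M).1 hM.isUnit)

theorem Matrix.PosDef.inv_mul_self {M : Matrix (Fin m) (Fin m) ℝ} (hM : M.PosDef) :
    M⁻¹ * M = 1 := Matrix.nonsing_inv_mul _ ((Matrix.isUnit_iff_isUnit_det M).1 hM.isUnit)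

/-- Expand the square around $WP$. On the imaginary axis $\operatorname{Re}(z\,v^*Pv)=0$, so the
cross terms reduce to $A^\top P+PA$ and complete the Riccati expression. -/
theorem trace_freq_eq (hW : W.PosDef) (hP : Pᵀ = P) {z : ℂ} (hz : z.re = 0)
    (V : Matrix (Fin m) (Fin 2) ℝ) :
    ((V * rot z - A * V)ᵀ * W⁻¹ * (V * rot z - A * V)).trace =
      (Vᵀ * Q * V).trace - (Vᵀ * ric W A Q P * V).trace +
      ((V * rot z - (A + W * P) * V)ᵀ * W⁻¹ * (V * rot z - (A + W * P) * V)).trace := by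
  set Z := V * rot z - A * V with hZ
  have hY : V * rot z - (A + W * P) * V = Z - W * (P * V) := by
    rw [hZ, Matrix.add_mul, Matrix.mul_assoc]; abel
  have hYt : (Z - W * (P * V))ᵀ = Zᵀ - (P * V)ᵀ * W := by
    rw [Matrix.transpose_sub, Matrix.transpose_mul W, hW.transpose_eq]
  have h1 : (Z - W * (P * V))ᵀ * W⁻¹ * (Z - W * (P * V)) =
      Zᵀ * W⁻¹ * Z - Zᵀ * (P * V) - (P * V)ᵀ * Z + (P * V)ᵀ * (W * (P * V)) := by
    rw [hYt, Matrix.sub_mul, Matrix.mul_assoc _ W, hW.mul_inv_self, Matrix.mul_one,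
      Matrix.sub_mul, Matrix.mul_sub (Zᵀ * W⁻¹), Matrix.mul_sub ((P * V)ᵀ),
      ← Matrix.mul_assoc (Zᵀ * W⁻¹) W, Matrix.mul_assoc _ W⁻¹ W, hW.inv_mul_self, Matrix.mul_one]
    abel
  have h2 : (Zᵀ * (P * V)).trace = ((P * V)ᵀ * Z).trace := by
    rw [← Matrix.trace_transpose, Matrix.transpose_mul, Matrix.transpose_transpose]
  have h3 : ((P * V)ᵀ * Z).trace = -(Vᵀ * (P * A) * V).trace := by
    rw [hZ, Matrix.mul_sub, Matrix.trace_sub, Matrix.transpose_mul, hP, ← Matrix.mul_assoc,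
      trace_mul_rot_eq_zero hP hz, zero_sub]
    simp only [Matrix.mul_assoc]
  have h4 : (Vᵀ * (Aᵀ * P) * V).trace = (Vᵀ * (P * A) * V).trace := by
    rw [← Matrix.trace_transpose]
    simp only [Matrix.transpose_mul, Matrix.transpose_transpose, hP, Matrix.mul_assoc]
  have h5 : ((P * V)ᵀ * (W * (P * V))).trace = (Vᵀ * (P * W * P) * V).trace := by
    rw [Matrix.transpose_mul, hP]; simp only [Matrix.mul_assoc]
  rw [hY, h1]
  simp only [ric, Matrix.mul_add, Matrix.add_mul, Matrix.trace_add, Matrix.trace_sub, h2, h3, h4,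
    h5]
  ring

/-- Eigenvalues in the open right half-plane are excluded by the limit. One on the imaginary axis
would annihilate the square in `trace_freq_eq`, against the strict inequality. -/
theorem isHurwitz_of_tendsto {ι : Type*} {l : Filter ι} [l.NeBot] (hW : W.PosDef)
    (hfr : FreqPos W A Q) (hP : Pᵀ = P) (hr : ric W A Q P = 0)
    {f : ι → Matrix (Fin m) (Fin m) ℝ} (hf : Tendsto f l (𝓝 (A + W * P)))
    (hH : ∀ᶠ i in l, IsHurwitz (f i)) : IsHurwitz (A + W * P) := by
  rw [isHurwitz_iff]
  intro z V hz hV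
  rcases hz.lt_or_eq with h | h
  · exact eq_zero_of_tendsto_isHurwitz hf hH h hV
  · by_contra hne
    have h1 := hfr z V h.symm hne
    rw [trace_freq_eq (Q := Q) hW hP h.symm, hr, hV] at h1
    simp at h1

theorem mul_inv_mul_closed (hW : W.PosDef) (hr : ric W A Q P = 0) (hP : Pᵀ = P) :
    (A + W * P)ᵀ * W⁻¹ * (A + W * P) = Aᵀ * W⁻¹ * A - Q := by
  rw [transpose_closed hW.transpose_eq hP, Matrix.add_mul, Matrix.mul_assoc P, hW.mul_inv_self,
    Matrix.mul_one, eq_sub_iff_add_eq, ← add_zero (Aᵀ * W⁻¹ * A), ← hr, ric, Matrix.mul_add,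
    Matrix.add_mul, Matrix.add_mul, ← Matrix.mul_assoc _ W P, Matrix.mul_assoc _ W⁻¹ W,
    hW.inv_mul_self, Matrix.mul_one, ← Matrix.mul_assoc P]
  abel

/-- $(A+WP)^\top W^{-1}(A+WP)=A^\top W^{-1}A-Q$ bounds $A+WP$, and hence $P$, independently of
$Q\ge0$. -/
theorem exists_norm_bound (hW : W.PosDef) (A : Matrix (Fin m) (Fin m) ℝ) :
    ∃ r : ℝ, ∀ Q P : Matrix (Fin m) (Fin m) ℝ, Q.PosSemidef → Pᵀ = P → ric W A Q P = 0 →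
      ‖P‖ ≤ r := by
  obtain ⟨c, hc, hcW⟩ := hW.inv.exists_le_trace_quad
  refine ⟨‖W⁻¹‖ * (√((Aᵀ * W⁻¹ * A).trace / c) + ‖A‖), fun Q P hQ hP hr => ?_⟩
  have h1 : ‖A + W * P‖ ≤ √((Aᵀ * W⁻¹ * A).trace / c) := by
    apply Real.le_sqrt_of_sq_le
    rw [le_div_iff₀ hc, mul_comm]
    calc c * ‖A + W * P‖ ^ 2 ≤ c * ((A + W * P)ᵀ * (A + W * P)).trace := by
          gcongr; exact norm_sq_le_trace _
      _ ≤ ((A + W * P)ᵀ * W⁻¹ * (A + W * P)).trace := hcW _ _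
      _ = (Aᵀ * W⁻¹ * A).trace - Q.trace := by rw [mul_inv_mul_closed hW hr hP, Matrix.trace_sub]
      _ ≤ _ := sub_le_self _ hQ.trace_nonneg
  have h2 : P = W⁻¹ * ((A + W * P) - A) := by
    rw [add_sub_cancel_left, ← Matrix.mul_assoc, hW.inv_mul_self, Matrix.one_mul]
  calc ‖P‖ = ‖W⁻¹ * ((A + W * P) - A)‖ := by rw [← h2]
    _ ≤ ‖W⁻¹‖ * (‖A + W * P‖ + ‖A‖) := by
        refine (norm_mul_le _ _).trans ?_
        gcongr
        exact norm_sub_le _ _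
    _ ≤ _ := by gcongr

theorem FreqPos.mono (hfr : FreqPos W A Q) (hQ : Q.PosSemidef) {t : ℝ} (ht : t ≤ 1) :
    FreqPos W A (t • Q) := by
  intro z V hz hV
  refine lt_of_le_of_lt ?_ (hfr z V hz hV)
  have := hQ.trace_quad_nonneg V
  simp only [Matrix.mul_smul, Matrix.smul_mul, Matrix.trace_smul, smul_eq_mul]
  nlinarith

/-- Strict bounded real lemma: the frequency domain inequality yields a stabilizing solution. -/
theorem exists_isStab (hW : W.PosDef) (hA : IsHurwitz A) (hQ : Q.PosSemidef)
    (hfr : FreqPos W A Q) : ∃ P, IsStab W A Q P := by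
  -- Continuity method: `T` collects the $t$ for which the weight $tQ$ admits a stabilizing
  -- solution, and $P=0$ serves at $t=0$.
  set T : Set ℝ := {t | ∃ P, IsStab W A (t • Q) P} with hT
  obtain ⟨r, hr⟩ := exists_norm_bound hW A
  have hcont : Continuous fun p : ℝ × Matrix (Fin m) (Fin m) ℝ => ric W A (p.1 • Q) p.2 := by
    unfold ric
    fun_prop
  -- Closedness: the solutions are bounded uniformly in $t$, and a limit point is still stabilizing
  -- by the frequency inequality.
  have hclosed : IsClosed (T ∩ Set.Icc 0 1) := by
    refine IsSeqClosed.isClosed fun t t₀ ht ht₀ => ?_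
    have htI : t₀ ∈ Set.Icc (0 : ℝ) 1 := isClosed_Icc.mem_of_tendsto ht₀
      (Eventually.of_forall fun j => (ht j).2)
    refine ⟨?_, htI⟩
    choose p hp using fun j => (ht j).1
    have hball : ∀ j, p j ∈ Metric.closedBall (0 : Matrix (Fin m) (Fin m) ℝ) r := fun j => by
      rw [mem_closedBall_zero_iff]
      exact hr _ _ (hQ.smul (ht j).2.1) (hp j).symm (hp j).eq
    have : ProperSpace (Matrix (Fin m) (Fin m) ℝ) := FiniteDimensional.proper ℝ _
    obtain ⟨P, -, φ, hφ, hlim⟩ :=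
      (isCompact_closedBall (0 : Matrix (Fin m) (Fin m) ℝ) r).tendsto_subseq hball
    have hlimt := ht₀.comp hφ.tendsto_atTop
    have hPsym : Pᵀ = P := by
      have h1 := ((continuous_id.matrix_transpose).tendsto P).comp hlim
      exact tendsto_nhds_unique (h1.congr fun j => (hp (φ j)).symm) hlim
    have hPr : ric W A (t₀ • Q) P = 0 := by
      have h1 := (hcont.tendsto (t₀, P)).comp (hlimt.prodMk_nhds hlim)
      exact tendsto_nhds_unique h1 (tendsto_const_nhds.congr fun j => (hp (φ j)).eq.symm)
    have hF : Tendsto (fun j => A + W * p (φ j)) atTop (𝓝 (A + W * P)) :=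
      (hlim.const_mul W).const_add A
    exact ⟨P, hPsym, hPr, isHurwitz_of_tendsto hW (hfr.mono hQ htI.2) hPsym hPr hF
      (Eventually.of_forall fun j => (hp (φ j)).hurwitz)⟩
  have h0 : (0 : ℝ) ∈ T := ⟨0, by simp, by simp [ric], by simpa using hA⟩
  have hsub := hclosed.Icc_subset_of_forall_mem_nhdsWithin h0 (by
    rintro t ⟨⟨P, hP⟩, -⟩
    have hev := hP.eventually_exists hW.transpose_eq univ_mem
    have hc : Continuous fun t : ℝ => (A, t • Q) := by fun_prop
    have h1 := (hc.tendsto t).eventually hev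
    refine mem_nhdsWithin_of_mem_nhds ?_
    filter_upwards [h1] with t' ht'
    obtain ⟨P', -, h⟩ := ht' (by simp [hQ.transpose_eq])
    exact ⟨P', h⟩)
  obtain ⟨P, hP⟩ := hsub (Set.right_mem_Icc.2 zero_le_one)
  exact ⟨P, by simpa using hP⟩

end FrequencyDomain

/-! ### Transfer functions and the uniform frequency margin -/

section Transfer

variable {m n l k : ℕ}

theorem norm_complexVec_sq (V : Matrix (Fin m) (Fin 2) ℝ) :
    ‖WithLp.toLp 2 (complexVec V)‖ ^ 2 = (Vᵀ * V).trace := by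
  rw [EuclideanSpace.norm_sq_eq]
  simp only [Matrix.trace, Matrix.diag, Matrix.mul_apply, Matrix.transpose_apply,
    Fin.sum_univ_two, ← Finset.sum_add_distrib]
  refine Finset.sum_congr rfl fun i _ => ?_
  change ‖complexVec V i‖ ^ 2 = _
  rw [← Complex.normSq_eq_norm_sq, Complex.normSq_apply]
  rfl

theorem complexVec_resolvent {A : Matrix (Fin m) (Fin m) ℝ} (z : ℂ)
    (V : Matrix (Fin m) (Fin 2) ℝ) :
    (z • (1 : Matrix (Fin m) (Fin m) ℂ) - A.map Complex.ofReal) *ᵥ complexVec V =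
      complexVec (V * rot z - A * V) := by
  rw [Matrix.sub_mulVec, Matrix.smul_mulVec, Matrix.one_mulVec, map_mulVec_complexVec,
    smul_complexVec, complexVec_sub]

theorem IsHurwitz.isUnit_det_resolvent {A : Matrix (Fin m) (Fin m) ℝ} (hA : IsHurwitz A) {z : ℂ}
    (hz : 0 ≤ z.re) :
    IsUnit (z • (1 : Matrix (Fin m) (Fin m) ℂ) - A.map Complex.ofReal).det := by
  rw [isUnit_iff_ne_zero]
  intro h0
  obtain ⟨v, hv, h⟩ := Matrix.exists_mulVec_eq_zero_iff.2 h0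
  obtain ⟨V, rfl⟩ := complexVec_surjective v
  rw [complexVec_resolvent, complexVec_eq_zero, sub_eq_zero] at h
  exact hv (complexVec_eq_zero.2 ((isHurwitz_iff A).1 hA z V hz h.symm))

theorem transferFunction_mulVec {A : Matrix (Fin m) (Fin m) ℝ} (hA : IsHurwitz A)
    (B : Matrix (Fin m) (Fin n) ℝ) (C : Matrix (Fin l) (Fin m) ℝ) {z : ℂ} (hz : 0 ≤ z.re)
    {V : Matrix (Fin m) (Fin 2) ℝ} {U : Matrix (Fin n) (Fin 2) ℝ}
    (h : V * rot z - A * V = B * U) :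
    transferFunction A B C z *ᵥ complexVec U = complexVec (C * V) := by
  rw [transferFunction, ← Matrix.mulVec_mulVec, map_mulVec_complexVec, ← h, ← complexVec_resolvent,
    Matrix.mulVec_mulVec, Matrix.mul_assoc, Matrix.nonsing_inv_mul _ (hA.isUnit_det_resolvent hz),
    Matrix.mul_one, map_mulVec_complexVec]

theorem IsHurwitz.exists_resolvent {A : Matrix (Fin m) (Fin m) ℝ} (hA : IsHurwitz A) {z : ℂ}
    (hz : 0 ≤ z.re) (Y : Matrix (Fin m) (Fin 2) ℝ) :
    ∃ V : Matrix (Fin m) (Fin 2) ℝ, V * rot z - A * V = Y := by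
  obtain ⟨V, hV⟩ := complexVec_surjective
    ((z • (1 : Matrix (Fin m) (Fin m) ℂ) - A.map Complex.ofReal)⁻¹ *ᵥ complexVec Y)
  refine ⟨V, complexVec_injective ?_⟩
  rw [← complexVec_resolvent, hV, Matrix.mulVec_mulVec,
    Matrix.mul_nonsing_inv _ (hA.isUnit_det_resolvent hz), Matrix.one_mulVec]

theorem trace_mulVec_le (G : Matrix (Fin l) (Fin n) ℂ) {U : Matrix (Fin n) (Fin 2) ℝ}
    {Y : Matrix (Fin l) (Fin 2) ℝ} (h : G *ᵥ complexVec U = complexVec Y) :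
    (Yᵀ * Y).trace ≤ ‖G‖ ^ 2 * (Uᵀ * U).trace := by
  have h1 := Matrix.l2_opNorm_mulVec G (WithLp.toLp 2 (complexVec U))
  change ‖WithLp.toLp 2 (G *ᵥ complexVec U)‖ ≤ _ at h1
  rw [h] at h1
  rw [← norm_complexVec_sq, ← norm_complexVec_sq, ← mul_pow]
  gcongr

theorem norm_le_of_trace_le {G : Matrix (Fin l) (Fin n) ℂ} {c : ℝ} (hc : 0 ≤ c)
    (h : ∀ U : Matrix (Fin n) (Fin 2) ℝ, ∀ Y : Matrix (Fin l) (Fin 2) ℝ,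
      G *ᵥ complexVec U = complexVec Y → (Yᵀ * Y).trace ≤ c ^ 2 * (Uᵀ * U).trace) : ‖G‖ ≤ c := by
  rw [Matrix.l2_opNorm_def]
  refine ContinuousLinearMap.opNorm_le_bound _ hc fun x => ?_
  obtain ⟨U, hU⟩ := complexVec_surjective x.ofLp
  obtain ⟨Y, hY⟩ := complexVec_surjective (G *ᵥ x.ofLp)
  have h1 := h U Y (by rw [hU, hY])
  rw [← norm_complexVec_sq, ← norm_complexVec_sq, hU, hY, ← mul_pow] at h1
  exact le_of_sq_le_sq h1 (by positivity)

variable {W A Q P : Matrix (Fin m) (Fin m) ℝ}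

theorem two_trace_transpose_mul_le (V Y : Matrix (Fin m) (Fin k) ℝ) :
    2 * (Vᵀ * Y).trace ≤ (Vᵀ * V).trace + (Yᵀ * Y).trace := by
  have h := trace_transpose_mul_self_nonneg (V - Y)
  have h1 : (Yᵀ * V).trace = (Vᵀ * Y).trace := by
    rw [← Matrix.trace_transpose, Matrix.transpose_mul, Matrix.transpose_transpose]
  simp only [Matrix.transpose_sub, Matrix.sub_mul, Matrix.mul_sub, Matrix.trace_sub, h1] at h
  linarith

/-- Uniform bound of the resolvent of a Hurwitz matrix along the imaginary axis. -/
theorem IsHurwitz.exists_resolvent_bound {F : Matrix (Fin m) (Fin m) ℝ} (hF : IsHurwitz F) :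
    ∃ κ : ℝ, 0 ≤ κ ∧ ∀ (z : ℂ) (V : Matrix (Fin m) (Fin 2) ℝ), z.re = 0 →
      (Vᵀ * V).trace ≤ κ * ((V * rot z - F * V)ᵀ * (V * rot z - F * V)).trace := by
  obtain ⟨X, hX⟩ := exists_lyapunov hF (-1)
  have hXt := (lyapunov_posDef hF Matrix.PosDef.one hX).transpose_eq
  refine ⟨4 * ‖Xᵀ * X‖, by positivity, fun z V hz => ?_⟩
  set Y := V * rot z - F * V with hY
  have h1 : (Vᵀ * (X * Y)).trace = -(Vᵀ * (X * F) * V).trace := by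
    rw [hY, Matrix.mul_sub, Matrix.mul_sub, Matrix.trace_sub, ← Matrix.mul_assoc X,
      ← Matrix.mul_assoc Vᵀ, ← Matrix.mul_assoc Vᵀ, trace_mul_rot_eq_zero hXt hz]
    simp only [Matrix.mul_assoc, zero_sub]
  have h2 : (Vᵀ * (Fᵀ * X) * V).trace = (Vᵀ * (X * F) * V).trace := by
    rw [← Matrix.trace_transpose]
    simp only [Matrix.transpose_mul, Matrix.transpose_transpose, hXt, Matrix.mul_assoc]
  have h3 : (Vᵀ * V).trace = 2 * (Vᵀ * (X * Y)).trace := by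
    have h4 : (Vᵀ * (Fᵀ * X + X * F) * V).trace = -(Vᵀ * V).trace := by rw [hX]; simp
    rw [Matrix.mul_add, Matrix.add_mul, Matrix.trace_add, h2] at h4
    linarith
  -- With the factor 2 inside, $2|V|^2=4\operatorname{tr}(V^\top XY)\le|V|^2+4|XY|^2$, so $|V|^2$ is
  -- absorbed and the constant $4\|X^\top X\|$ results.
  have h5 := two_trace_transpose_mul_le V ((2 : ℝ) • (X * Y))
  have h6 : (Yᵀ * (Xᵀ * X) * Y).trace ≤ ‖Xᵀ * X‖ * (Yᵀ * Y).trace :=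
    trace_quad_le _ (by simp) _
  simp only [Matrix.transpose_smul, Matrix.smul_mul, Matrix.mul_smul, Matrix.trace_smul,
    smul_eq_mul, Matrix.transpose_mul, Matrix.mul_assoc] at h5 h6
  linarith

theorem trace_quad_add_le {M : Matrix (Fin m) (Fin m) ℝ} (hM : M.PosSemidef)
    (Y Z : Matrix (Fin m) (Fin k) ℝ) :
    ((Y + Z)ᵀ * M * (Y + Z)).trace ≤ 2 * (Yᵀ * M * Y).trace + 2 * (Zᵀ * M * Z).trace := by
  have h := hM.trace_quad_nonneg (Y - Z)
  simp only [Matrix.transpose_sub, Matrix.transpose_add, Matrix.sub_mul, Matrix.mul_sub,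
    Matrix.add_mul, Matrix.mul_add, Matrix.trace_sub, Matrix.trace_add] at h ⊢
  linarith

/-- A pointwise strict inequality would not bound the supremum over frequencies strictly, so a
uniform $\theta<1$ is produced. With $Y=(z-A)V$ and $Y'=(z-A-WP)V$, one has $Y=Y'+WPV$, and the
stable resolvent controls $V$ by $Y'$. Thus $|Y|^2\le L|Y'|^2$ in the $W^{-1}$ norm, and
$\theta=1-1/L$. -/
theorem IsStab.exists_freq_bound (hW : W.PosDef) (h : IsStab W A Q P) :
    ∃ θ : ℝ, 0 ≤ θ ∧ θ < 1 ∧ ∀ (z : ℂ) (V : Matrix (Fin m) (Fin 2) ℝ), z.re = 0 →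
      (Vᵀ * Q * V).trace ≤ θ * ((V * rot z - A * V)ᵀ * W⁻¹ * (V * rot z - A * V)).trace := by
  obtain ⟨κ, hκ, hres⟩ := h.hurwitz.exists_resolvent_bound
  obtain ⟨c, hc, hcW⟩ := hW.inv.exists_le_trace_quad
  set L := 2 + 2 * (‖P * W * P‖ * (κ / c)) with hL
  have hL2 : 2 ≤ L := by rw [hL]; have : 0 ≤ κ / c := by positivity
                         have := mul_nonneg (norm_nonneg (P * W * P)) this; linarith
  have hL1 : L⁻¹ ≤ 1 := inv_le_one_of_one_le₀ (by linarith)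
  refine ⟨1 - L⁻¹, by linarith, by have : 0 < L⁻¹ := by positivity
                                   linarith, fun z V hz => ?_⟩
  have hid := trace_freq_eq (A := A) (Q := Q) hW h.symm hz V
  rw [h.eq, Matrix.mul_zero, Matrix.zero_mul, Matrix.trace_zero, sub_zero] at hid
  set Y := V * rot z - A * V with hY
  set Y' := V * rot z - (A + W * P) * V with hY'
  have hYY : Y = Y' + W * (P * V) := by
    rw [hY, hY', Matrix.add_mul, Matrix.mul_assoc]; abel
  have h1 : (Vᵀ * V).trace ≤ κ / c * (Y'ᵀ * W⁻¹ * Y').trace := by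
    calc (Vᵀ * V).trace ≤ κ * (Y'ᵀ * Y').trace := hres z V hz
      _ = κ / c * (c * (Y'ᵀ * Y').trace) := by field_simp
      _ ≤ _ := by gcongr; exact hcW _ _
  have h2 : ((W * (P * V))ᵀ * W⁻¹ * (W * (P * V))).trace ≤ ‖P * W * P‖ * (Vᵀ * V).trace := by
    have h3 : (W * (P * V))ᵀ * W⁻¹ * (W * (P * V)) = Vᵀ * (P * W * P) * V := by
      rw [Matrix.transpose_mul W, hW.transpose_eq, Matrix.mul_assoc _ W, hW.mul_inv_self,
        Matrix.mul_one, Matrix.transpose_mul, h.symm]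
      simp only [Matrix.mul_assoc]
    rw [h3]
    refine trace_quad_le _ ?_ _
    simp only [Matrix.transpose_mul, h.symm, hW.transpose_eq, Matrix.mul_assoc]
  have h4 : (Yᵀ * W⁻¹ * Y).trace ≤ L * (Y'ᵀ * W⁻¹ * Y').trace := by
    calc (Yᵀ * W⁻¹ * Y).trace ≤ 2 * (Y'ᵀ * W⁻¹ * Y').trace +
          2 * ((W * (P * V))ᵀ * W⁻¹ * (W * (P * V))).trace := by
          rw [hYY]; exact trace_quad_add_le hW.inv.posSemidef _ _
      _ ≤ 2 * (Y'ᵀ * W⁻¹ * Y').trace +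
          2 * (‖P * W * P‖ * (κ / c * (Y'ᵀ * W⁻¹ * Y').trace)) := by
          gcongr
          exact h2.trans (by gcongr)
      _ = _ := by rw [hL]; ring
  have h5 : L⁻¹ * (Yᵀ * W⁻¹ * Y).trace ≤ (Y'ᵀ * W⁻¹ * Y').trace := by
    rw [inv_mul_le_iff₀ (by linarith)]; exact h4
  rw [sub_mul, one_mul]
  linarith

end Transfer

/-! ### Feasible gains and their Riccati equation -/

namespace MixedDesign

variable {m d n l : ℕ} (S : MixedDesign m d n l)

/-- The disturbance weight `γ⁻² D Dᵀ`. -/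
noncomputable def W : Matrix (Fin m) (Fin m) ℝ := (S.γ ^ 2)⁻¹ • (S.D * S.Dᵀ)

/-- The state weight `Cᵀ C + Kᵀ R K` of the closed loop. -/
def Q (K : Matrix (Fin d) (Fin m) ℝ) : Matrix (Fin m) (Fin m) ℝ := S.Cᵀ * S.C + Kᵀ * S.R * K

variable {S} {K : Matrix (Fin d) (Fin m) ℝ}

theorem posDef_W (hγ : 0 < S.γ) (hDD : (S.D * S.Dᵀ).PosDef) : S.W.PosDef :=
  hDD.smul (by positivity)

theorem W_inv (hγ : 0 < S.γ) (hDD : (S.D * S.Dᵀ).PosDef) :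
    S.W⁻¹ = S.γ ^ 2 • (S.D * S.Dᵀ)⁻¹ := by
  refine Matrix.inv_eq_right_inv ?_
  rw [W, Matrix.smul_mul, Matrix.mul_smul, hDD.mul_inv_self, smul_smul,
    inv_mul_cancel₀ (by positivity), one_smul]

theorem posSemidef_R : S.R.PosSemidef := posSemidef_transpose_mul_self S.E

theorem posSemidef_Q : (S.Q K).PosSemidef :=
  (posSemidef_transpose_mul_self S.C).add (posSemidef_R.transpose_mul_mul K)

theorem transpose_mul_output (hEC : S.Eᵀ * S.C = 0) :
    (S.C - S.E * K)ᵀ * (S.C - S.E * K) = S.Q K := by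
  have hCE : S.Cᵀ * S.E = 0 := by
    rw [← Matrix.transpose_transpose (S.Cᵀ * S.E), Matrix.transpose_mul, Matrix.transpose_transpose,
      hEC, Matrix.transpose_zero]
  have h1 : S.Cᵀ * (S.E * K) = 0 := by rw [← Matrix.mul_assoc, hCE, Matrix.zero_mul]
  have h2 : (S.E * K)ᵀ * S.C = 0 := by
    rw [Matrix.transpose_mul, Matrix.mul_assoc, hEC, Matrix.mul_zero]
  rw [Matrix.transpose_sub, Matrix.sub_mul, Matrix.mul_sub, Matrix.mul_sub, h1, h2,
    Matrix.transpose_mul, Q, R]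
  simp only [Matrix.mul_assoc]
  abel

theorem trace_quad_output (hEC : S.Eᵀ * S.C = 0) (V : Matrix (Fin m) (Fin 2) ℝ) :
    (((S.C - S.E * K) * V)ᵀ * ((S.C - S.E * K) * V)).trace = (Vᵀ * S.Q K * V).trace := by
  rw [← transpose_mul_output hEC, Matrix.transpose_mul]
  simp only [Matrix.mul_assoc]

theorem freqPos_of_mem_feasible (hγ : 0 < S.γ) (hEC : S.Eᵀ * S.C = 0)
    (hDD : (S.D * S.Dᵀ).PosDef) (hK : K ∈ S.feasible) :
    FreqPos S.W (S.A - S.B * K) (S.Q K) := by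
  intro z V hz hV
  obtain ⟨hH, hN⟩ := hK
  set Y := V * rot z - (S.A - S.B * K) * V with hY
  have hY0 : Y ≠ 0 := fun h0 => hV ((isHurwitz_iff _).1 hH z V hz.ge (sub_eq_zero.1 h0).symm)
  have hzI : z = Complex.I * (z.im : ℂ) := by apply Complex.ext <;> simp [hz]
  have hG : ‖S.closedLoop K z‖ < S.γ := by
    have h1 : ENNReal.ofReal ‖S.closedLoop K z‖ ≤ hinfNorm (S.closedLoop K) := by
      conv_lhs => rw [hzI]
      exact le_iSup (fun ω : ℝ => ENNReal.ofReal ‖S.closedLoop K (Complex.I * (ω : ℂ))‖) z.im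
    exact (ENNReal.ofReal_lt_ofReal_iff hγ).1 (h1.trans_lt hN)
  -- The input of least norm with $DU=Y$, for which $|U|^2$ is exactly the $(DD^\top)^{-1}$ form of
  -- $Y$.
  set U := S.Dᵀ * ((S.D * S.Dᵀ)⁻¹ * Y) with hU
  have hDU : S.D * U = Y := by
    rw [hU, ← Matrix.mul_assoc, ← Matrix.mul_assoc, hDD.mul_inv_self, Matrix.one_mul]
  have h2 := trace_mulVec_le _
    (transferFunction_mulVec hH S.D (S.C - S.E * K) hz.ge (hY.symm.trans hDU.symm))
  have h3 : (Uᵀ * U).trace = (Yᵀ * (S.D * S.Dᵀ)⁻¹ * Y).trace := by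
    rw [hU, Matrix.transpose_mul, Matrix.transpose_transpose, Matrix.transpose_mul,
      Matrix.transpose_nonsing_inv, hDD.transpose_eq, Matrix.mul_assoc, ← Matrix.mul_assoc S.D,
      ← Matrix.mul_assoc (S.D * S.Dᵀ), hDD.mul_inv_self, Matrix.one_mul]
  have h4 := hDD.inv.trace_quad_pos hY0
  rw [trace_quad_output hEC] at h2
  rw [W_inv hγ hDD, Matrix.mul_smul, Matrix.smul_mul, Matrix.trace_smul, smul_eq_mul, ← h3]
  refine h2.trans_lt ?_
  rw [← h3] at h4
  have h5 : ‖transferFunction (S.A - S.B * K) S.D (S.C - S.E * K) z‖ < S.γ := hG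
  gcongr

theorem posSemidef_one_sub_proj (hDD : (S.D * S.Dᵀ).PosDef) :
    (1 - S.Dᵀ * (S.D * S.Dᵀ)⁻¹ * S.D).PosSemidef := by
  have h : 1 - S.Dᵀ * (S.D * S.Dᵀ)⁻¹ * S.D =
      (1 - S.Dᵀ * (S.D * S.Dᵀ)⁻¹ * S.D)ᵀ * (1 - S.Dᵀ * (S.D * S.Dᵀ)⁻¹ * S.D) := by
    have h1 : (1 - S.Dᵀ * (S.D * S.Dᵀ)⁻¹ * S.D)ᵀ = 1 - S.Dᵀ * (S.D * S.Dᵀ)⁻¹ * S.D := by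
      simp only [Matrix.transpose_sub, Matrix.transpose_one, Matrix.transpose_mul,
        Matrix.transpose_transpose, Matrix.transpose_nonsing_inv, Matrix.mul_assoc]
    have h2 : S.Dᵀ * (S.D * S.Dᵀ)⁻¹ * S.D * (S.Dᵀ * (S.D * S.Dᵀ)⁻¹ * S.D) =
        S.Dᵀ * (S.D * S.Dᵀ)⁻¹ * S.D := by
      calc _ = S.Dᵀ * (S.D * S.Dᵀ)⁻¹ * ((S.D * S.Dᵀ) * (S.D * S.Dᵀ)⁻¹) * S.D := by
            simp only [Matrix.mul_assoc]
        _ = _ := by rw [hDD.mul_inv_self, Matrix.mul_one]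
    rw [h1, Matrix.sub_mul, Matrix.one_mul, Matrix.mul_sub, Matrix.mul_one, h2, sub_self, sub_zero]
  rw [h]
  exact posSemidef_transpose_mul_self _

theorem mem_feasible_of_isStab (hγ : 0 < S.γ) (hEC : S.Eᵀ * S.C = 0)
    (hDD : (S.D * S.Dᵀ).PosDef) (hH : IsHurwitz (S.A - S.B * K)) {P : Matrix (Fin m) (Fin m) ℝ}
    (hP : IsStab S.W (S.A - S.B * K) (S.Q K) P) : K ∈ S.feasible := by
  obtain ⟨θ, hθ0, hθ1, hθ⟩ := hP.exists_freq_bound (posDef_W hγ hDD)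
  refine ⟨hH, lt_of_le_of_lt (b := ENNReal.ofReal (√θ * S.γ)) (iSup_le fun ω => ?_) ?_⟩
  · refine ENNReal.ofReal_le_ofReal (norm_le_of_trace_le (by positivity) fun U Y hUY => ?_)
    have hz : (Complex.I * (ω : ℂ)).re = 0 := by simp
    obtain ⟨V, hV⟩ := hH.exists_resolvent hz.ge (S.D * U)
    have h1 := transferFunction_mulVec hH S.D (S.C - S.E * K) hz.ge hV
    have h2 : Y = (S.C - S.E * K) * V := complexVec_injective (hUY.symm.trans h1)
    have h3 := hθ _ V hz
    rw [h2, trace_quad_output hEC, mul_pow, Real.sq_sqrt hθ0]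
    refine h3.trans ?_
    rw [mul_assoc]
    refine mul_le_mul_of_nonneg_left ?_ hθ0
    rw [hV, W_inv hγ hDD, Matrix.mul_smul, Matrix.smul_mul, Matrix.trace_smul, smul_eq_mul]
    refine mul_le_mul_of_nonneg_left ?_ (sq_nonneg _)
    -- $D^\top(DD^\top)^{-1}D$ is an orthogonal projection, so no input $U$ is shorter than the
    -- least-norm input producing $DU$.
    have h4 := trace_quad_mono (posSemidef_one_sub_proj hDD) U
    rw [Matrix.transpose_mul]
    simpa only [Matrix.mul_assoc, Matrix.one_mul] using h4
  · rw [ENNReal.ofReal_lt_ofReal_iff hγ]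
    have : √θ < 1 := by rw [Real.sqrt_lt' one_pos]; simpa using hθ1
    nlinarith

theorem isStabilizingSolution_iff {P : Matrix (Fin m) (Fin m) ℝ} :
    S.IsStabilizingSolution K P ↔ P.PosSemidef ∧ IsStab S.W (S.A - S.B * K) (S.Q K) P := by
  have h1 : (S.γ ^ 2)⁻¹ • (P * (S.D * S.Dᵀ) * P) = P * S.W * P := by
    simp only [W, Matrix.mul_smul, Matrix.smul_mul]
  have h2 : (S.γ ^ 2)⁻¹ • (S.D * S.Dᵀ * P) = S.W * P := by
    simp only [W, Matrix.smul_mul]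
  rw [IsStabilizingSolution, h1, h2, add_assoc _ (S.Cᵀ * S.C)]
  exact ⟨fun h => ⟨h.1, h.1.transpose_eq, h.2.1, h.2.2⟩, fun h => ⟨h.1, h.2.eq, h.2.hurwitz⟩⟩

theorem exists_isStabilizingSolution (hγ : 0 < S.γ) (hEC : S.Eᵀ * S.C = 0)
    (hDD : (S.D * S.Dᵀ).PosDef) (hH : IsHurwitz (S.A - S.B * K))
    (hfr : FreqPos S.W (S.A - S.B * K) (S.Q K)) : K ∈ S.feasible ∧
      S.IsStabilizingSolution K (S.P K) := by
  have hW := posDef_W hγ hDD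
  obtain ⟨P, hP⟩ := exists_isStab hW hH posSemidef_Q hfr
  have h : ∃ P, S.IsStabilizingSolution K P :=
    ⟨P, isStabilizingSolution_iff.2 ⟨hP.posSemidef hW.posSemidef hH posSemidef_Q, hP⟩⟩
  refine ⟨mem_feasible_of_isStab hγ hEC hDD hH hP, ?_⟩
  rw [MixedDesign.P, dif_pos h]
  exact h.choose_spec

end MixedDesign

/-! ### Game Riccati equation and policy improvement -/

/-- A symmetric matrix factors through another one with smaller kernel. -/
theorem exists_eq_mul_of_ker_le {m : ℕ} {M N : Matrix (Fin m) (Fin m) ℝ} (hM : Mᵀ = M)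
    (hN : Nᵀ = N) (h : ∀ x, M *ᵥ x = 0 → N *ᵥ x = 0) : ∃ Z, N = M * Z := by
  have hker : LinearMap.ker (Matrix.toLin' M) ≤ LinearMap.ker (Matrix.toLin' N) := by
    intro x hx
    simp only [LinearMap.mem_ker, Matrix.toLin'_apply] at hx ⊢
    exact h x hx
  obtain ⟨g, hg⟩ := LinearMap.exists_extend
    ((LinearMap.ker (Matrix.toLin' M)).liftQ (Matrix.toLin' N) hker ∘ₗ
      (Matrix.toLin' M).quotKerEquivRange.symm.toLinearMap)
  have hfac : g ∘ₗ Matrix.toLin' M = Matrix.toLin' N := by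
    refine LinearMap.ext fun x => ?_
    have h1 := LinearMap.congr_fun hg ⟨Matrix.toLin' M x, LinearMap.mem_range_self _ x⟩
    have h2 : (Matrix.toLin' M).quotKerEquivRange.symm
        ⟨Matrix.toLin' M x, LinearMap.mem_range_self _ x⟩ = Submodule.Quotient.mk x :=
      LinearMap.quotKerEquivRange_symm_apply_image _ _ _
    rw [LinearMap.comp_apply, LinearMap.comp_apply, LinearEquiv.coe_coe, h2] at h1
    exact h1
  have h3 := congrArg LinearMap.toMatrix' hfac
  rw [LinearMap.toMatrix'_comp, LinearMap.toMatrix'_toLin', LinearMap.toMatrix'_toLin'] at h3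
  refine ⟨(LinearMap.toMatrix' g)ᵀ, ?_⟩
  have h4 := congrArg Matrix.transpose h3
  rw [Matrix.transpose_mul, hM, hN] at h4
  exact h4.symm

theorem exists_eq_mul_of_le {m : ℕ} {M N : Matrix (Fin m) (Fin m) ℝ} (hM : Mᵀ = M)
    (hN : N.PosSemidef) (hMN : (M - N).PosSemidef) : ∃ Z, N = M * Z := by
  refine exists_eq_mul_of_ker_le hM hN.transpose_eq fun x hx => ?_
  refine (hN.dotProduct_mulVec_zero_iff x).1 (le_antisymm ?_ (hN.dotProduct_mulVec_nonneg x))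
  have h1 := hMN.dotProduct_mulVec_nonneg x
  rw [Matrix.sub_mulVec, hx, zero_sub, dotProduct_neg] at h1
  linarith

/-- For a stabilizing solution `P`, solutions of the eigenvector equation modulo `ker P` lie in
`ker P`. -/
theorem IsStab.mul_eq_zero_of_eigen {m : ℕ} {W A Q P : Matrix (Fin m) (Fin m) ℝ}
    (hQ : Q.PosSemidef) (h : IsStab W A Q P) {z : ℂ} (hz : 0 ≤ z.re)
    {U : Matrix (Fin m) (Fin 2) ℝ} (hU : P * ((A + W * P) * U) = P * (U * rot z)) :
    P * U = 0 := by
  let T : Matrix (Fin m) (Fin 2) ℝ →ₗ[ℝ] Matrix (Fin m) (Fin 2) ℝ :=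
    { toFun := fun V => (A + W * P) * V - V * rot z
      map_add' := fun V V' => by simp only [Matrix.mul_add, Matrix.add_mul]; abel
      map_smul' := fun c V => by simp [smul_sub] }
  have hT : ∀ V, T V = (A + W * P) * V - V * rot z := fun V => rfl
  have hTinj : Function.Injective T := by
    rw [← LinearMap.ker_eq_bot, LinearMap.ker_eq_bot']
    exact fun V hV => (isHurwitz_iff _).1 h.hurwitz z V hz (sub_eq_zero.1 hV)
  let p : Submodule ℝ (Matrix (Fin m) (Fin 2) ℝ) :=
    { carrier := {V | P * V = 0}
      add_mem' := fun {V V'} hV hV' => by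
        simp only [Set.mem_ofPred_eq] at hV hV' ⊢
        rw [Matrix.mul_add, hV, hV', add_zero]
      zero_mem' := Matrix.mul_zero P
      smul_mem' := fun c V hV => by
        simp only [Set.mem_ofPred_eq] at hV ⊢
        rw [Matrix.mul_smul, hV, smul_zero] }
  have hp : ∀ V, V ∈ p ↔ P * V = 0 := fun V => Iff.rfl
  -- If $PV=0$, the Riccati equation gives first $QV=0$ and then $PAV=0$. Thus `T` preserves `p`;
  -- being injective in finite dimension it is bijective on `p`, and $TU\in p$ forces $U\in p$.
  have hmaps : ∀ V ∈ p, T V ∈ p := by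
    intro V hV
    rw [hp] at hV
    have hPt : Vᵀ * P = 0 := by
      rw [← Matrix.transpose_transpose (Vᵀ * P), Matrix.transpose_mul, h.symm,
        Matrix.transpose_transpose, hV, Matrix.transpose_zero]
    have h1 : (Vᵀ * Q * V).trace = 0 := by
      have h2 : Vᵀ * ric W A Q P * V = Vᵀ * Q * V := by
        have e1 : Vᵀ * (Aᵀ * P) * V = 0 := by simp only [Matrix.mul_assoc, hV, Matrix.mul_zero]
        have e2 : Vᵀ * (P * A) * V = 0 := by
          rw [← Matrix.mul_assoc, hPt, Matrix.zero_mul, Matrix.zero_mul]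
        have e3 : Vᵀ * (P * W * P) * V = 0 := by simp only [Matrix.mul_assoc, hV, Matrix.mul_zero]
        simp only [ric, Matrix.mul_add, Matrix.add_mul, e1, e2, e3, zero_add, add_zero]
      rw [← h2, h.eq]; simp
    have h3 : Q * V = 0 := hQ.mul_eq_zero_of_trace_quad h1
    have h4 := congrArg (· * V) h.eq
    simp only [ric, Matrix.add_mul, Matrix.mul_assoc, hV, h3, Matrix.mul_zero, add_zero, zero_add,
      Matrix.zero_mul] at h4
    rw [hp, hT, Matrix.mul_sub, ← Matrix.mul_assoc P V, hV, Matrix.zero_mul, sub_zero,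
      Matrix.add_mul, Matrix.mul_assoc W, hV, Matrix.mul_zero, add_zero, h4]
  have hsurj : Function.Surjective (T.restrict hmaps) := by
    rw [← LinearMap.injective_iff_surjective]
    intro x y hxy
    exact Subtype.ext (hTinj (congrArg Subtype.val hxy))
  obtain ⟨⟨V, hV⟩, hVU⟩ := hsurj ⟨T U, by rw [hp, hT, Matrix.mul_sub, hU, sub_self]⟩
  have h5 : V = U := hTinj (congrArg Subtype.val hVU)
  rw [← h5]
  exact hV

theorem trace_transpose_mul_comm {m k : ℕ} (X Y : Matrix (Fin m) (Fin k) ℝ) :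
    (Xᵀ * Y).trace = (Yᵀ * X).trace := by
  rw [← Matrix.trace_transpose, Matrix.transpose_mul, Matrix.transpose_transpose]

theorem trace_mul_rot {m : ℕ} {P : Matrix (Fin m) (Fin m) ℝ} (hP : Pᵀ = P) (z : ℂ)
    (V : Matrix (Fin m) (Fin 2) ℝ) :
    (Vᵀ * (P * V * rot z)).trace = z.re * (Vᵀ * (P * V)).trace := by
  have h1 : (Vᵀ * (P * V * rot z)).trace = ((rot z)ᵀ * (Vᵀ * (P * V))).trace := by
    rw [← Matrix.trace_transpose]
    simp only [Matrix.transpose_mul, Matrix.transpose_transpose, hP, Matrix.mul_assoc]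
  have h2 : (Vᵀ * (P * V * rot z)).trace + ((rot z)ᵀ * (Vᵀ * (P * V))).trace =
      2 * z.re * (Vᵀ * (P * V)).trace := by
    rw [← Matrix.mul_assoc, Matrix.trace_mul_comm _ (rot z), add_comm, ← Matrix.trace_add,
      ← Matrix.add_mul, rot_transpose_add]
    simp
  linarith

namespace MixedDesign

variable {m d n l : ℕ} {S : MixedDesign m d n l}

/-- The standing assumptions on the data of the design problem. -/
structure Regular (S : MixedDesign m d n l) : Prop where
  γ_pos : 0 < S.γ
  output : S.Eᵀ * S.C = 0
  posDef_R : S.R.PosDef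
  detectable : IsDetectable S.A S.C
  posDef_D : (S.D * S.Dᵀ).PosDef

/-- The quadratic weight `γ⁻² D Dᵀ - B R⁻¹ Bᵀ` of the game Riccati equation. -/
noncomputable def gameW (S : MixedDesign m d n l) : Matrix (Fin m) (Fin m) ℝ :=
  S.W - S.B * S.R⁻¹ * S.Bᵀ

/-- The residual `R K - Bᵀ P` of the stationarity condition. -/
def resid (S : MixedDesign m d n l) (K : Matrix (Fin d) (Fin m) ℝ)
    (P : Matrix (Fin m) (Fin m) ℝ) : Matrix (Fin d) (Fin m) ℝ := S.R * K - S.Bᵀ * P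

/-- The closed-loop Riccati expression of the gain `K`. -/
noncomputable def gainRic (S : MixedDesign m d n l) (K : Matrix (Fin d) (Fin m) ℝ)
    (P : Matrix (Fin m) (Fin m) ℝ) : Matrix (Fin m) (Fin m) ℝ :=
  ric S.W (S.A - S.B * K) (S.Q K) P

namespace Regular

variable (h : S.Regular) {K K' : Matrix (Fin d) (Fin m) ℝ} {P : Matrix (Fin m) (Fin m) ℝ}
include h

theorem posDef_W : S.W.PosDef := MixedDesign.posDef_W h.γ_pos h.posDef_D

theorem gameW_symm : S.gameWᵀ = S.gameW := by
  simp only [gameW, Matrix.transpose_sub, h.posDef_W.transpose_eq, Matrix.transpose_mul,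
    Matrix.transpose_transpose, h.posDef_R.inv.transpose_eq, Matrix.mul_assoc]

/-- The closed-loop Riccati expression is the game Riccati expression plus a square. -/
theorem gainRic_eq (K : Matrix (Fin d) (Fin m) ℝ) (hP : Pᵀ = P) :
    S.gainRic K P = ric S.gameW S.A (S.Cᵀ * S.C) P + (S.resid K P)ᵀ * S.R⁻¹ * S.resid K P := by
  have hRt := h.posDef_R.transpose_eq
  have e1 : (S.resid K P)ᵀ * S.R⁻¹ * S.resid K P =
      Kᵀ * S.R * K - (S.B * K)ᵀ * P - P * (S.B * K) + P * (S.B * S.R⁻¹ * S.Bᵀ) * P := by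
    have e2 : (S.resid K P)ᵀ * S.R⁻¹ = Kᵀ - P * S.B * S.R⁻¹ := by
      rw [resid, Matrix.transpose_sub, Matrix.transpose_mul, hRt, Matrix.transpose_mul,
        Matrix.transpose_transpose, hP, Matrix.sub_mul, Matrix.mul_assoc, h.posDef_R.mul_inv_self,
        Matrix.mul_one]
    have e3 : P * S.B * S.R⁻¹ * (S.R * K) = P * (S.B * K) := by
      rw [Matrix.mul_assoc (P * S.B), ← Matrix.mul_assoc S.R⁻¹, h.posDef_R.inv_mul_self,
        Matrix.one_mul, Matrix.mul_assoc]
    rw [e2, resid, Matrix.sub_mul, Matrix.mul_sub, Matrix.mul_sub, e3, Matrix.transpose_mul]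
    simp only [Matrix.mul_assoc]
    abel
  rw [e1, gainRic, ric, ric, Q, gameW, Matrix.transpose_sub]
  simp only [Matrix.sub_mul, Matrix.mul_sub]
  abel

theorem resid_eq_zero_iff : S.resid K P = 0 ↔ K = S.R⁻¹ * S.Bᵀ * P := by
  rw [resid, sub_eq_zero]
  constructor
  · intro hK
    rw [Matrix.mul_assoc, ← hK, ← Matrix.mul_assoc, h.posDef_R.inv_mul_self, Matrix.one_mul]
  · rintro rfl
    rw [Matrix.mul_assoc, ← Matrix.mul_assoc, h.posDef_R.mul_inv_self, Matrix.one_mul]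

omit h in
theorem closed_eq_game (hK : K = S.R⁻¹ * S.Bᵀ * P) :
    S.A - S.B * K + S.W * P = S.A + S.gameW * P := by
  rw [hK, gameW, Matrix.sub_mul]
  simp only [Matrix.mul_assoc]
  abel

theorem isStabilizing (hK : K ∈ S.feasible) : S.IsStabilizingSolution K (S.P K) :=
  (exists_isStabilizingSolution h.γ_pos h.output h.posDef_D hK.1
    (freqPos_of_mem_feasible h.γ_pos h.output h.posDef_D hK)).2

theorem isStab (hK : K ∈ S.feasible) : IsStab S.W (S.A - S.B * K) (S.Q K) (S.P K) :=
  (isStabilizingSolution_iff.1 (h.isStabilizing hK)).2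

theorem posSemidef_P (hK : K ∈ S.feasible) : (S.P K).PosSemidef := (h.isStabilizing hK).1

theorem P_eq (hK : K ∈ S.feasible) (hP : IsStab S.W (S.A - S.B * K) (S.Q K) P) : P = S.P K :=
  hP.unique h.posDef_W.transpose_eq (h.isStab hK)

omit h in
-- Hautus test: output injection does not act on an eigenvector in the kernel of $C$.
theorem eq_zero_of_detectable (hdet : IsDetectable S.A S.C) {z : ℂ} (hz : 0 ≤ z.re)
    {V : Matrix (Fin m) (Fin 2) ℝ} (hA : S.A * V = V * rot z) (hC : S.C * V = 0) : V = 0 := by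
  obtain ⟨L, hL⟩ := hdet
  refine (isHurwitz_iff _).1 hL z V hz ?_
  rw [Matrix.sub_mul, Matrix.mul_assoc, hC, Matrix.mul_zero, sub_zero, hA]

theorem mul_eq_zero_of_Q {V : Matrix (Fin m) (Fin 2) ℝ} (hQ : (Vᵀ * S.Q K * V).trace = 0) :
    S.C * V = 0 ∧ K * V = 0 := by
  have h1 : (Vᵀ * S.Q K * V).trace =
      ((S.C * V)ᵀ * (S.C * V)).trace + ((K * V)ᵀ * S.R * (K * V)).trace := by
    rw [Q, Matrix.mul_add, Matrix.add_mul, Matrix.trace_add, Matrix.transpose_mul,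
      Matrix.transpose_mul]
    simp only [Matrix.mul_assoc]
  have h2 := trace_transpose_mul_self_nonneg (S.C * V)
  have h3 := h.posDef_R.posSemidef.trace_quad_nonneg (K * V)
  refine ⟨trace_transpose_mul_self_eq_zero.1 (by linarith), ?_⟩
  exact h.posDef_R.eq_zero_of_mul_eq_zero
    (h.posDef_R.posSemidef.mul_eq_zero_of_trace_quad (by linarith))

/-- A gain with a nonnegative definite supersolution is stabilizing. -/
theorem isHurwitz_of_supersolution (hP : P.PosSemidef) (hN : (-S.gainRic K P).PosSemidef) :
    IsHurwitz (S.A - S.B * K) := by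
  rw [isHurwitz_iff]
  intro z V hz hV
  have h1 := hN.trace_quad_nonneg V
  have h2 : -S.gainRic K P = -((S.A - S.B * K)ᵀ * P + P * (S.A - S.B * K)) - S.Q K -
      P * S.W * P := by
    rw [gainRic, ric]; abel
  rw [h2, Matrix.mul_sub, Matrix.sub_mul, Matrix.mul_sub, Matrix.sub_mul, Matrix.mul_neg,
    Matrix.neg_mul, Matrix.trace_sub, Matrix.trace_sub, Matrix.trace_neg,
    trace_lyapunov_of_eigen hV] at h1
  have h3 := mul_nonneg hz (hP.trace_quad_nonneg V)
  have h4 : 0 ≤ (Vᵀ * S.Q K * V).trace := posSemidef_Q.trace_quad_nonneg V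
  have h5 := (posSemidef_mul_mul_self h.posDef_W.posSemidef hP.transpose_eq).trace_quad_nonneg V
  -- For $\operatorname{Re}z\ge0$ every term of `h1` is nonpositive while the sum is nonnegative. So
  -- the weight vanishes on `V`, which is then an eigenvector of $A$ invisible to the output.
  obtain ⟨hC, hKV⟩ := h.mul_eq_zero_of_Q (K := K) (V := V) (by linarith)
  rw [Matrix.sub_mul, Matrix.mul_assoc, hKV, Matrix.mul_zero, sub_zero] at hV
  exact eq_zero_of_detectable h.detectable hz hV hC

/-- Policy improvement: if `P_K` is a supersolution for `K'`, then `K'` is feasible and better. -/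
theorem improvement (hK : K ∈ S.feasible) (hN : (-S.gainRic K' (S.P K)).PosSemidef)
    (hker : ∀ V : Matrix (Fin m) (Fin 2) ℝ, S.gainRic K' (S.P K) * V = 0 → K' * V = K * V) :
    K' ∈ S.feasible ∧ (S.P K - S.P K').PosSemidef := by
  have hP := h.posSemidef_P hK
  have hH := h.isHurwitz_of_supersolution hP hN
  have hfr : FreqPos S.W (S.A - S.B * K') (S.Q K') := by
    intro z V hz hV
    have hid := trace_freq_eq (A := S.A - S.B * K') (Q := S.Q K') h.posDef_W hP.transpose_eq hz V
    have h1 := hN.trace_quad_nonneg V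
    rw [Matrix.mul_neg, Matrix.neg_mul, Matrix.trace_neg] at h1
    set Y := V * rot z - (S.A - S.B * K' + S.W * S.P K) * V with hY
    have h2 := h.posDef_W.inv.posSemidef.trace_quad_nonneg Y
    rw [hid]
    change 0 ≤ -(Vᵀ * ric S.W (S.A - S.B * K') (S.Q K') (S.P K) * V).trace at h1
    -- Failure of the strict inequality makes both nonnegative terms vanish. Then $K'V=KV$ by
    -- `hker`, and `V` becomes an imaginary-axis eigenvector of the Hurwitz matrix $A-BK+WP_K$.
    by_contra hcon
    have h3 : (Yᵀ * S.W⁻¹ * Y).trace = 0 := by linarith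
    have h4 : (Vᵀ * ric S.W (S.A - S.B * K') (S.Q K') (S.P K) * V).trace = 0 := by linarith
    have hY0 : Y = 0 := by
      by_contra hne
      exact (h.posDef_W.inv.trace_quad_pos hne).ne' h3
    have h5 : -S.gainRic K' (S.P K) * V = 0 := hN.mul_eq_zero_of_trace_quad (by
      rw [Matrix.mul_neg, Matrix.neg_mul, Matrix.trace_neg, neg_eq_zero]; exact h4)
    have h6 := hker V (by rwa [Matrix.neg_mul, neg_eq_zero] at h5)
    refine hV ((isHurwitz_iff _).1 (h.isStab hK).hurwitz z V hz.ge ?_)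
    rw [hY, sub_eq_zero] at hY0
    rw [hY0, Matrix.add_mul, Matrix.add_mul, Matrix.sub_mul, Matrix.sub_mul, Matrix.mul_assoc S.B,
      Matrix.mul_assoc S.B, h6]
  have hK' := (exists_isStabilizingSolution h.γ_pos h.output h.posDef_D hH hfr).1
  exact ⟨hK', (h.isStab hK').le_of_ric_nonpos h.posDef_W.posSemidef hP.transpose_eq hN⟩

/-- A solution of the game Riccati equation below some `P_K` is stabilizing. -/
theorem isStab_game (hK : K ∈ S.feasible) (hP : P.PosSemidef) (hle : (S.P K - P).PosSemidef)
    (hr : ric S.gameW S.A (S.Cᵀ * S.C) P = 0) : IsStab S.gameW S.A (S.Cᵀ * S.C) P := by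
  refine ⟨hP.transpose_eq, hr, (isHurwitz_iff _).2 fun z V hz hV => ?_⟩
  have hst := h.isStab hK
  set P₀ := S.P K with hP₀
  set Ks := S.R⁻¹ * S.Bᵀ * P with hKs
  have hRKs : S.R * Ks = S.Bᵀ * P := sub_eq_zero.1 (h.resid_eq_zero_iff.2 hKs)
  -- $P\le P_0$ makes the range of $P$ part of that of $P_0$. Writing $PV=P_0U$ gives one costate
  -- `w` shared by the two Riccati equations, which can then be compared.
  obtain ⟨Z, hZ⟩ := exists_eq_mul_of_le hst.symm hP hle
  obtain ⟨U, hUV⟩ : ∃ U : Matrix (Fin m) (Fin 2) ℝ, P₀ * U = P * V :=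
    ⟨Z * V, by rw [← Matrix.mul_assoc, ← hZ]⟩
  set w := P * V with hw
  have hRw : S.R * (Ks * V) = S.Bᵀ * w := by
    rw [hw, ← Matrix.mul_assoc, hRKs, Matrix.mul_assoc]
  -- the eigenvector equation of the costate
  have hco : S.Aᵀ * w + w * rot z + S.Cᵀ * (S.C * V) = 0 := by
    have h1 := congrArg (· * V) hr
    simp only [ric, Matrix.zero_mul] at h1
    have h2 : w * rot z = P * ((S.A + S.gameW * P) * V) := by
      rw [hV, hw, Matrix.mul_assoc]
    rw [h2, ← h1, hw]
    simp only [Matrix.add_mul, Matrix.mul_add, Matrix.mul_assoc]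
    abel
  have hp : (Vᵀ * (w * rot z)).trace = z.re * (Vᵀ * w).trace := trace_mul_rot hP.transpose_eq z V
  have hq : (Uᵀ * (w * rot z)).trace = z.re * (Uᵀ * w).trace := by
    rw [← hUV]; exact trace_mul_rot hst.symm z U
  have hcoV := congrArg (fun M => (Vᵀ * M).trace) hco
  have hcoU := congrArg (fun M => (Uᵀ * M).trace) hco
  simp only [Matrix.mul_add, Matrix.trace_add, hp, hq, Matrix.mul_zero, Matrix.trace_zero]
    at hcoV hcoU
  -- Combine $(U-V)^*P(U-V)\ge0$ with $U^*PU\le U^*P_0U=U^*w$.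
  have hpq : (Uᵀ * w).trace ≤ (Vᵀ * w).trace := by
    have h1 := hP.trace_quad_nonneg (U - V)
    have h2 := trace_quad_mono hle U
    simp only [Matrix.transpose_sub, Matrix.mul_assoc, Matrix.sub_mul, Matrix.mul_sub,
      Matrix.trace_sub, hUV] at h1 h2
    have h3 : (Vᵀ * (P * U)).trace = (Uᵀ * w).trace := by
      rw [trace_transpose_mul_comm, Matrix.transpose_mul, hP.transpose_eq, Matrix.mul_assoc]
    linarith
  -- the two Riccati equations as quadratic forms
  have hq0 : 2 * (Uᵀ * (S.Aᵀ * w)).trace - 2 * ((K * U)ᵀ * (S.Bᵀ * w)).trace +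
      ((S.C * U)ᵀ * (S.C * U)).trace + ((K * U)ᵀ * (S.R * (K * U))).trace +
      (wᵀ * (S.W * w)).trace = 0 := by
    have h1 := congrArg (fun M => (Uᵀ * M * U).trace) hst.eq
    have e1 : (Uᵀ * (P₀ * (S.A * U))).trace = (Uᵀ * (S.Aᵀ * w)).trace := by
      rw [trace_transpose_mul_comm, Matrix.transpose_mul, Matrix.transpose_mul, hst.symm,
        Matrix.mul_assoc, Matrix.mul_assoc, hUV]
    have e2 : (Uᵀ * (P₀ * (S.B * (K * U)))).trace = ((K * U)ᵀ * (S.Bᵀ * w)).trace := by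
      rw [trace_transpose_mul_comm, Matrix.transpose_mul, Matrix.transpose_mul, hst.symm,
        Matrix.mul_assoc, Matrix.mul_assoc, hUV]
    have e3 : (Uᵀ * (P₀ * (S.W * w))).trace = (wᵀ * (S.W * w)).trace := by
      rw [← hUV, Matrix.transpose_mul, hst.symm, Matrix.mul_assoc]
    have e4 : (Uᵀ * (Kᵀ * (S.Bᵀ * w))).trace = ((K * U)ᵀ * (S.Bᵀ * w)).trace := by
      rw [Matrix.transpose_mul, Matrix.mul_assoc]
    simp only [ric, Q, Matrix.mul_add, Matrix.add_mul, Matrix.transpose_sub, Matrix.sub_mul,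
      Matrix.mul_sub, Matrix.mul_assoc, Matrix.trace_add, Matrix.trace_sub, Matrix.mul_zero,
      Matrix.zero_mul, Matrix.trace_zero, Matrix.transpose_mul, hUV] at h1
    rw [e1, e2, e3, e4] at h1
    simp only [Matrix.transpose_mul, Matrix.mul_assoc] at h1 ⊢
    linarith
  have hq1 : 2 * (Vᵀ * (S.Aᵀ * w)).trace + ((S.C * V)ᵀ * (S.C * V)).trace -
      ((Ks * V)ᵀ * (S.Bᵀ * w)).trace + (wᵀ * (S.W * w)).trace = 0 := by
    have h1 := congrArg (fun M => (Vᵀ * M * V).trace) hr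
    have e1 : (Vᵀ * (P * (S.A * V))).trace = (Vᵀ * (S.Aᵀ * w)).trace := by
      rw [trace_transpose_mul_comm, Matrix.transpose_mul, Matrix.transpose_mul, hP.transpose_eq,
        Matrix.mul_assoc, Matrix.mul_assoc]
    have e2 : Vᵀ * (P * (S.B * (S.R⁻¹ * (S.Bᵀ * w)))) = (Ks * V)ᵀ * (S.Bᵀ * w) := by
      rw [Matrix.transpose_mul, hKs, Matrix.transpose_mul, Matrix.transpose_mul,
        Matrix.transpose_transpose, hP.transpose_eq, h.posDef_R.inv.transpose_eq]
      simp only [Matrix.mul_assoc]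
    have e3 : (Vᵀ * (P * (S.W * w))).trace = (wᵀ * (S.W * w)).trace := by
      rw [hw, Matrix.transpose_mul, hP.transpose_eq, Matrix.mul_assoc]
    simp only [ric, gameW, Matrix.mul_add, Matrix.add_mul, Matrix.sub_mul,
      Matrix.mul_sub, Matrix.mul_assoc, Matrix.trace_add, Matrix.trace_sub, Matrix.mul_zero,
      Matrix.zero_mul, Matrix.trace_zero, ← hw] at h1
    rw [e1, e2, e3] at h1
    simp only [Matrix.transpose_mul, Matrix.mul_assoc] at h1 ⊢
    linarith
  -- completion of squares
  have hsqC : ((S.C * U - S.C * V)ᵀ * (S.C * U - S.C * V)).trace =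
      ((S.C * U)ᵀ * (S.C * U)).trace - 2 * (Uᵀ * (S.Cᵀ * (S.C * V))).trace +
      ((S.C * V)ᵀ * (S.C * V)).trace := by
    have e1 := trace_transpose_mul_comm (S.C * V) (S.C * U)
    simp only [Matrix.transpose_sub, Matrix.sub_mul, Matrix.mul_sub, Matrix.trace_sub, e1]
    simp only [Matrix.transpose_mul, Matrix.mul_assoc]
    ring
  have hsqR : ((K * U - Ks * V)ᵀ * S.R * (K * U - Ks * V)).trace =
      ((K * U)ᵀ * (S.R * (K * U))).trace - 2 * ((K * U)ᵀ * (S.Bᵀ * w)).trace +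
      ((Ks * V)ᵀ * (S.Bᵀ * w)).trace := by
    have e1 : ((Ks * V)ᵀ * (S.R * (K * U))).trace = ((K * U)ᵀ * (S.Bᵀ * w)).trace := by
      rw [trace_transpose_mul_comm, Matrix.transpose_mul, h.posDef_R.transpose_eq,
        Matrix.mul_assoc, hRw]
    simp only [Matrix.transpose_sub, Matrix.sub_mul, Matrix.mul_sub, Matrix.trace_sub,
      Matrix.mul_assoc _ S.R, hRw, e1]
    ring
  have hCVV : (Vᵀ * (S.Cᵀ * (S.C * V))).trace = ((S.C * V)ᵀ * (S.C * V)).trace := by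
    rw [Matrix.transpose_mul, Matrix.mul_assoc]
  -- Subtracting `hq1` from `hq0` and eliminating $A^\top w$ by the costate equation leaves
  -- $|CU-CV|^2+|KU-K_sV|_R^2+2\operatorname{Re}z\,(V^*w-U^*w)=0$, with all three terms nonnegative.
  have n1 := trace_transpose_mul_self_nonneg (S.C * U - S.C * V)
  have n2 := h.posDef_R.posSemidef.trace_quad_nonneg (K * U - Ks * V)
  have n3 := mul_nonneg hz (sub_nonneg.2 hpq)
  rw [hCVV] at hcoV
  have hC : S.C * U = S.C * V := sub_eq_zero.1 (trace_transpose_mul_self_eq_zero.1 (by linarith))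
  have hKU : K * U = Ks * V := by
    rw [← sub_eq_zero]
    by_contra hne
    have := h.posDef_R.trace_quad_pos hne
    linarith
  -- The equation of $P_0$ applied to $U$, minus the costate equation, says that $U$ is an
  -- eigenvector of $A-BK+WP_0$ modulo $\ker P_0$, so $P_0U=0$. What then remains of `V` is excluded
  -- by detectability.
  have hw0 : w = 0 := by
    rw [← hUV]
    refine hst.mul_eq_zero_of_eigen posSemidef_Q hz ?_
    have h1 := congrArg (· * U) hst.eq
    simp only [ric, Q, Matrix.add_mul, Matrix.transpose_sub, Matrix.sub_mul, Matrix.mul_sub,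
      Matrix.mul_assoc, Matrix.zero_mul, Matrix.transpose_mul, hUV, hC, hKU, hRw] at h1
    have h2 : P₀ * (U * rot z) = w * rot z := by rw [← Matrix.mul_assoc, hUV]
    rw [h2, ← sub_eq_zero]
    simp only [Matrix.add_mul, Matrix.mul_add, Matrix.sub_mul, Matrix.mul_sub, Matrix.mul_assoc,
      hUV, hKU]
    refine (?_ : _ = _ - _).trans ((congrArg₂ (· - ·) h1 hco).trans (sub_zero 0))
    abel
  have hKsV : Ks * V = 0 := by
    apply h.posDef_R.eq_zero_of_mul_eq_zero
    rw [hRw, hw0, Matrix.mul_zero]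
  have hCV : S.C * V = 0 := by
    rw [hw0, Matrix.mul_zero, Matrix.zero_mul, zero_add, zero_add] at hco
    rw [← trace_transpose_mul_self_eq_zero, ← hCVV, hco, Matrix.mul_zero, Matrix.trace_zero]
  refine eq_zero_of_detectable h.detectable hz ?_ hCV
  rw [← hV, ← closed_eq_game hKs, Matrix.add_mul, Matrix.sub_mul, Matrix.mul_assoc S.B, hKsV,
    Matrix.mul_assoc S.W, ← hw, hw0]
  simp

end Regular

end MixedDesign

/-! ### Descent steps and global convergence -/

/-- A decreasing sequence of positive semidefinite matrices converges. -/
theorem exists_tendsto_of_posSemidef_antitone {m : ℕ} {p : ℕ → Matrix (Fin m) (Fin m) ℝ}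
    (hp : ∀ k, (p k).PosSemidef) (hanti : ∀ k, (p k - p (k + 1)).PosSemidef) :
    ∃ L : Matrix (Fin m) (Fin m) ℝ, Tendsto p atTop (𝓝 L) ∧ L.PosSemidef ∧
      ∀ k, (p k - L).PosSemidef := by
  have hle : ∀ j i, (p j - p (j + i)).PosSemidef := by
    intro j i
    induction i with
    | zero => simpa using Matrix.PosSemidef.zero
    | succ i ih =>
      have := ih.add (hanti (j + i))
      rwa [sub_add_sub_cancel] at this
  have htr : Antitone fun k => (p k).trace := antitone_nat_of_succ_le fun k => by
    have := (hanti k).trace_nonneg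
    rw [Matrix.trace_sub] at this
    linarith
  have hbdd : BddBelow (Set.range fun k => (p k).trace) :=
    ⟨0, by rintro _ ⟨k, rfl⟩; exact (hp k).trace_nonneg⟩
  have hc := (tendsto_atTop_ciInf htr hbdd).cauchySeq
  have hcs : CauchySeq p := by
    rw [Metric.cauchySeq_iff'] at hc ⊢
    intro ε hε
    obtain ⟨N, hN⟩ := hc ε hε
    refine ⟨N, fun k hk => ?_⟩
    obtain ⟨i, rfl⟩ := Nat.exists_eq_add_of_le hk
    refine lt_of_le_of_lt ?_ (hN _ hk)
    rw [dist_comm, dist_eq_norm, dist_comm, Real.dist_eq]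
    refine (hle N i).norm_le_trace.trans ?_
    rw [Matrix.trace_sub]
    exact le_abs_self _
  obtain ⟨L, hL⟩ := cauchySeq_tendsto_of_complete hcs
  refine ⟨L, hL, isClosed_posSemidef.mem_of_tendsto hL (Eventually.of_forall hp), fun k => ?_⟩
  have h1 : Tendsto (fun i => p k - p (k + i)) atTop (𝓝 (p k - L)) :=
    (hL.comp ((tendsto_add_atTop_nat k).congr fun i => Nat.add_comm i k)).const_sub _
  exact isClosed_posSemidef.mem_of_tendsto h1 (Eventually.of_forall fun i => hle k i)

namespace MixedDesign

variable {m d n l : ℕ} {S : MixedDesign m d n l}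

/-- A gain update `K ↦ K - M (R K - Bᵀ P_K)` that decreases the Riccati expression by at least
`c` times the square of the residual. -/
structure IsDescentStep (S : MixedDesign m d n l)
    (step : Matrix (Fin d) (Fin m) ℝ → Matrix (Fin d) (Fin m) ℝ) (M : Matrix (Fin d) (Fin d) ℝ)
    (c : ℝ) : Prop where
  pos : 0 < c
  step_eq : ∀ K, step K = K - M * S.resid K (S.P K)
  quad : (Mᵀ + M - Mᵀ * S.R * M - c • 1).PosSemidef

namespace Regular

variable (h : S.Regular) {K : Matrix (Fin d) (Fin m) ℝ}
  {step : Matrix (Fin d) (Fin m) ℝ → Matrix (Fin d) (Fin m) ℝ} {M : Matrix (Fin d) (Fin d) ℝ}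
  {c : ℝ}
include h

/-- Here $M+M^\top-M^\top RM=4\eta-4\eta^2R$, and the stepsize bound says $4\eta^2\|R\|\le2\eta$. -/
theorem isDescentStep_npg {η : ℝ} (hη : 0 < η) (hηR : η * (2 * ‖S.R‖) ≤ 1) :
    S.IsDescentStep (S.npgStep η) ((2 * η) • 1) (2 * η) := by
  refine ⟨by positivity, fun K => ?_, ?_⟩
  · rw [npgStep, resid, Matrix.smul_mul, Matrix.one_mul]
  · have hc : ‖(4 * η ^ 2) • S.R‖ ≤ 2 * η := by
      rw [norm_smul, Real.norm_of_nonneg (by positivity)]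
      nlinarith
    have h1 := posSemidef_smul_one_sub (M := (4 * η ^ 2) • S.R)
      (by rw [Matrix.transpose_smul, h.posDef_R.transpose_eq]) hc
    convert h1 using 1
    simp only [Matrix.transpose_smul, Matrix.transpose_one, Matrix.smul_mul, Matrix.mul_smul,
      Matrix.one_mul, Matrix.mul_one, smul_smul]
    module

/-- Here $M+M^\top-M^\top RM=4\eta(1-\eta)R^{-1}$, so $c$ comes from a lower bound of $R^{-1}$. -/
theorem isDescentStep_gn {η : ℝ} (hη : 0 < η) (hη2 : η ≤ 1 / 2) :
    ∃ c, S.IsDescentStep (S.gnStep η) ((2 * η) • S.R⁻¹) c := by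
  obtain ⟨c, hc, hcR⟩ := h.posDef_R.inv.exists_smul_one_le
  have hpos : 0 < 4 * η * (1 - η) := by
    have : 0 < 1 - η := by linarith
    positivity
  refine ⟨4 * η * (1 - η) * c, by positivity, fun K => ?_, ?_⟩
  · rw [gnStep, resid, Matrix.smul_mul, Matrix.mul_sub, ← Matrix.mul_assoc,
      h.posDef_R.inv_mul_self, Matrix.one_mul, Matrix.mul_assoc]
  · convert hcR.smul hpos.le using 1
    simp only [Matrix.transpose_smul, h.posDef_R.inv.transpose_eq, Matrix.smul_mul,
      Matrix.mul_smul, h.posDef_R.inv_mul_self, Matrix.one_mul, smul_smul]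
    module

/-- With $P_K$ frozen the residual $E$ becomes $(1-RM)E$; only the square in `gainRic_eq` changes.
-/
theorem gainRic_sub_mul_resid (hP : (S.P K)ᵀ = S.P K) (M : Matrix (Fin d) (Fin d) ℝ) :
    S.gainRic (K - M * S.resid K (S.P K)) (S.P K) = S.gainRic K (S.P K) -
      (S.resid K (S.P K))ᵀ * (Mᵀ + M - Mᵀ * S.R * M) * S.resid K (S.P K) := by
  have e1 : S.resid (K - M * S.resid K (S.P K)) (S.P K) =
      (1 - S.R * M) * S.resid K (S.P K) := by
    rw [Matrix.sub_mul, Matrix.one_mul]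
    conv_lhs => rw [resid, Matrix.mul_sub, sub_right_comm]
    rw [Matrix.mul_assoc]
    rfl
  have e2 : (1 - S.R * M)ᵀ * S.R⁻¹ * (1 - S.R * M) = S.R⁻¹ - (Mᵀ + M - Mᵀ * S.R * M) := by
    rw [Matrix.transpose_sub, Matrix.transpose_one, Matrix.transpose_mul,
      h.posDef_R.transpose_eq, Matrix.sub_mul, Matrix.mul_assoc Mᵀ, h.posDef_R.mul_inv_self,
      Matrix.one_mul, Matrix.mul_one, Matrix.sub_mul, Matrix.mul_sub, Matrix.mul_sub,
      ← Matrix.mul_assoc, h.posDef_R.inv_mul_self, Matrix.mul_one, Matrix.mul_one, Matrix.one_mul,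
      Matrix.mul_assoc]
    abel
  rw [h.gainRic_eq _ hP, h.gainRic_eq _ hP, e1, Matrix.transpose_mul]
  set E := S.resid K (S.P K)
  have e3 : Eᵀ * (1 - S.R * M)ᵀ * S.R⁻¹ * ((1 - S.R * M) * E) =
      Eᵀ * ((1 - S.R * M)ᵀ * S.R⁻¹ * (1 - S.R * M)) * E := by simp only [Matrix.mul_assoc]
  rw [e3, e2, Matrix.mul_sub, Matrix.sub_mul]
  abel

theorem gainRic_step (hs : S.IsDescentStep step M c) (hK : K ∈ S.feasible) :
    -S.gainRic (step K) (S.P K) =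
      (S.resid K (S.P K))ᵀ * (Mᵀ + M - Mᵀ * S.R * M) * S.resid K (S.P K) := by
  rw [hs.step_eq, h.gainRic_sub_mul_resid (h.posSemidef_P hK).transpose_eq]
  have : S.gainRic K (S.P K) = 0 := (h.isStab hK).eq
  rw [this, zero_sub, neg_neg]

theorem posSemidef_gainRic_step (hs : S.IsDescentStep step M c) (hK : K ∈ S.feasible) :
    (-S.gainRic (step K) (S.P K) -
      c • ((S.resid K (S.P K))ᵀ * S.resid K (S.P K))).PosSemidef := by
  have h1 := hs.quad.transpose_mul_mul (S.resid K (S.P K))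
  convert h1 using 1
  rw [h.gainRic_step hs hK, Matrix.mul_sub _ _ (c • 1), Matrix.sub_mul _ (_ * (c • 1))]
  simp

/-- The kernel condition of `improvement` holds because the decrease dominates $cE^\top E$: where it
vanishes, so does $E$, and the gain does not move. -/
theorem step_mem (hs : S.IsDescentStep step M c) (hK : K ∈ S.feasible) :
    step K ∈ S.feasible ∧ (S.P K - S.P (step K)).PosSemidef := by
  have h1 := h.posSemidef_gainRic_step hs hK
  have h2 : (c • ((S.resid K (S.P K))ᵀ * S.resid K (S.P K))).PosSemidef :=
    (posSemidef_transpose_mul_self _).smul hs.pos.le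
  have h3 := h1.add h2
  rw [sub_add_cancel] at h3
  refine h.improvement hK h3 fun V hV => ?_
  have h4 := h1.trace_quad_nonneg V
  rw [Matrix.mul_sub, Matrix.sub_mul, Matrix.mul_assoc Vᵀ, Matrix.neg_mul, hV, neg_zero,
    Matrix.mul_zero, zero_sub, Matrix.trace_neg] at h4
  have h5 : (Vᵀ * (c • ((S.resid K (S.P K))ᵀ * S.resid K (S.P K))) * V).trace =
      c * ((S.resid K (S.P K) * V)ᵀ * (S.resid K (S.P K) * V)).trace := by
    simp only [Matrix.mul_smul, Matrix.smul_mul, Matrix.trace_smul, smul_eq_mul,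
      Matrix.transpose_mul, Matrix.mul_assoc]
  rw [h5] at h4
  have h6 := trace_transpose_mul_self_nonneg (S.resid K (S.P K) * V)
  have h7 : S.resid K (S.P K) * V = 0 := by
    rw [← trace_transpose_mul_self_eq_zero]
    have := hs.pos
    nlinarith
  rw [hs.step_eq, Matrix.sub_mul, Matrix.mul_assoc, h7, Matrix.mul_zero, sub_zero]

/-- The decrease of `tr P_K` controls the residual. -/
theorem norm_resid_sq_le (hs : S.IsDescentStep step M c) (hK : K ∈ S.feasible) :
    c * ‖S.resid K (S.P K)‖ ^ 2 ≤
      2 * m * ‖S.A - S.B * step K + S.W * S.P (step K)‖ * (S.P K - S.P (step K)).trace := by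
  obtain ⟨hK', hY⟩ := h.step_mem hs hK
  have h1 := (h.posSemidef_gainRic_step hs hK).trace_nonneg
  set E := S.resid K (S.P K)
  set F := S.A - S.B * step K + S.W * S.P (step K) with hF
  set Y := S.P K - S.P (step K) with hYdef
  have hst := h.isStab hK'
  -- Expanding at $P_{K'}$ turns the decrease of the Riccati expression into a Lyapunov term in `Y`.
  -- In the trace, $YWY\ge0$ is dropped and $|\operatorname{tr}(YF)|\le
  -- m\,\operatorname{tr}(Y)\,\|F\|$.
  have h2 : S.gainRic (step K) (S.P K) = Fᵀ * Y + Y * F + Y * S.W * Y := by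
    have := ric_sub_ric' S.W (S.A - S.B * step K) (S.Q (step K)) (S.P (step K)) (S.P K)
    rwa [hst.eq, sub_zero, ← transpose_closed h.posDef_W.transpose_eq hst.symm] at this
  have h3 : (Fᵀ * Y).trace = (Y * F).trace := by
    rw [← Matrix.trace_transpose, Matrix.transpose_mul, Matrix.transpose_transpose,
      hY.transpose_eq]
  have h4 := (posSemidef_mul_mul_self h.posDef_W.posSemidef hY.transpose_eq).trace_nonneg
  rw [Matrix.trace_sub, Matrix.trace_neg, h2, Matrix.trace_add, Matrix.trace_add, h3,
    Matrix.trace_smul, smul_eq_mul] at h1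
  have h5 : |(Y * F).trace| ≤ m * (Y.trace * ‖F‖) := by
    refine (abs_trace_le _).trans ?_
    gcongr
    refine (norm_mul_le _ _).trans ?_
    gcongr
    exact hY.norm_le_trace
  have h6 := neg_le_abs (Y * F).trace
  have h7 : c * ‖E‖ ^ 2 ≤ c * (Eᵀ * E).trace :=
    mul_le_mul_of_nonneg_left (norm_sq_le_trace E) hs.pos.le
  nlinarith

theorem gain_eq (K : Matrix (Fin d) (Fin m) ℝ) (P : Matrix (Fin m) (Fin m) ℝ) :
    K = S.R⁻¹ * (S.resid K P + S.Bᵀ * P) := by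
  rw [resid, sub_add_cancel, ← Matrix.mul_assoc, h.posDef_R.inv_mul_self, Matrix.one_mul]

omit h in
theorem continuous_ric {m : ℕ} (W A Q : Matrix (Fin m) (Fin m) ℝ) : Continuous (ric W A Q) := by
  unfold ric
  fun_prop

/-- The iterates of a descent step converge to a stabilizing solution of the game Riccati
equation and the corresponding gain. -/
theorem exists_tendsto_iterate (hs : S.IsDescentStep step M c) (hK : K ∈ S.feasible) :
    (∀ k : ℕ, step^[k] K ∈ S.feasible) ∧ ∃ L : Matrix (Fin m) (Fin m) ℝ,
      IsStab S.gameW S.A (S.Cᵀ * S.C) L ∧ L.PosSemidef ∧ (S.P K - L).PosSemidef ∧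
      Tendsto (fun k : ℕ => S.P (step^[k] K)) atTop (𝓝 L) ∧
      Tendsto (fun k : ℕ => step^[k] K) atTop (𝓝 (S.R⁻¹ * S.Bᵀ * L)) := by
  have hmem : ∀ k : ℕ, step^[k] K ∈ S.feasible := by
    intro k
    induction k with
    | zero => exact hK
    | succ k ih => rw [Function.iterate_succ_apply']; exact (h.step_mem hs ih).1
  refine ⟨hmem, ?_⟩
  set κ : ℕ → Matrix (Fin d) (Fin m) ℝ := fun k => step^[k] K with hκ
  have hsucc : ∀ k, κ (k + 1) = step (κ k) := fun k => Function.iterate_succ_apply' step k K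
  set p : ℕ → Matrix (Fin m) (Fin m) ℝ := fun k => S.P (κ k) with hp
  obtain ⟨L, hL, hLpos, hLle⟩ := exists_tendsto_of_posSemidef_antitone (p := p)
    (fun k => h.posSemidef_P (hmem k)) (fun k => by
      simp only [hp, hsucc]
      exact (h.step_mem hs (hmem k)).2)
  set E : ℕ → Matrix (Fin d) (Fin m) ℝ := fun k => S.resid (κ k) (p k) with hE
  have hgame : ∀ k, ric S.gameW S.A (S.Cᵀ * S.C) (p k) = -((E k)ᵀ * S.R⁻¹ * E k) := by
    intro k
    have h1 := h.gainRic_eq (κ k) (h.posSemidef_P (hmem k)).transpose_eq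
    have h2 : S.gainRic (κ k) (p k) = 0 := (h.isStab (hmem k)).eq
    exact eq_neg_of_add_eq_zero_left (h1.symm.trans h2)
  have hric := ((continuous_ric S.gameW S.A (S.Cᵀ * S.C)).tendsto L).comp hL
  -- the residuals are bounded
  obtain ⟨b, hb⟩ : ∃ b, ∀ k, ‖E k‖ ≤ b := by
    obtain ⟨r, hr, hrR⟩ := h.posDef_R.inv.exists_le_trace_quad
    have hbd : ∃ b, ∀ k, ‖ric S.gameW S.A (S.Cᵀ * S.C) (p k)‖ ≤ b := by
      obtain ⟨b, hb⟩ := (hric.norm).bddAbove_range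
      exact ⟨b, fun k => hb ⟨k, rfl⟩⟩
    obtain ⟨b, hb⟩ := hbd
    refine ⟨√(m * b / r), fun k => Real.le_sqrt_of_sq_le ?_⟩
    rw [le_div_iff₀ hr, mul_comm]
    have h1 := abs_trace_le (ric S.gameW S.A (S.Cᵀ * S.C) (p k))
    rw [hgame, Matrix.trace_neg, abs_neg, ← hgame] at h1
    calc r * ‖E k‖ ^ 2 ≤ r * ((E k)ᵀ * E k).trace := by gcongr; exact norm_sq_le_trace _
      _ ≤ ((E k)ᵀ * S.R⁻¹ * E k).trace := hrR _ _
      _ ≤ _ := le_abs_self _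
      _ ≤ m * ‖ric S.gameW S.A (S.Cᵀ * S.C) (p k)‖ := h1
      _ ≤ m * b := by gcongr; exact hb k
  obtain ⟨q, hq⟩ : ∃ q, ∀ k, ‖p k‖ ≤ q := by
    obtain ⟨q, hq⟩ := hL.norm.bddAbove_range
    exact ⟨q, fun k => hq ⟨k, rfl⟩⟩
  have hκb : ∀ k, ‖κ k‖ ≤ ‖S.R⁻¹‖ * (b + ‖S.Bᵀ‖ * q) := by
    intro k
    conv_lhs => rw [h.gain_eq (κ k) (p k)]
    refine (Matrix.l2_opNorm_mul _ _).trans ?_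
    gcongr
    refine (norm_add_le _ _).trans ?_
    gcongr
    · exact hb k
    · refine (Matrix.l2_opNorm_mul _ _).trans ?_
      gcongr
      exact hq k
  set β := ‖S.A‖ + ‖S.B‖ * (‖S.R⁻¹‖ * (b + ‖S.Bᵀ‖ * q)) + ‖S.W‖ * q with hβ
  have hF : ∀ k, ‖S.A - S.B * κ k + S.W * p k‖ ≤ β := by
    intro k
    refine (norm_add_le _ _).trans ?_
    rw [hβ]
    gcongr
    · refine (norm_sub_le _ _).trans ?_
      gcongr
      refine (Matrix.l2_opNorm_mul _ _).trans ?_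
      gcongr
      exact hκb k
    · refine (norm_mul_le _ _).trans ?_
      gcongr
      exact hq k
  -- The squared residual is bounded by a fixed multiple of the drop of $\operatorname{tr}P_k$,
  -- which tends to zero because the traces converge. A uniform bound `β` on the closed loops is
  -- what makes the multiple fixed.
  have hE0 : Tendsto E atTop (𝓝 0) := by
    have h1 : Tendsto (fun k => (p k - p (k + 1)).trace) atTop (𝓝 0) := by
      have h2 := hL.sub (hL.comp (tendsto_add_atTop_nat 1))
      rw [sub_self] at h2
      have h3 := ((continuous_id.matrix_trace).tendsto (0 : Matrix (Fin m) (Fin m) ℝ)).comp h2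
      rwa [id, Matrix.trace_zero] at h3
    have h4 : ∀ k, ‖E k‖ ^ 2 ≤ 2 * m * β / c * (p k - p (k + 1)).trace := by
      intro k
      have h5 := h.norm_resid_sq_le hs (hmem k)
      have h6 : 0 ≤ (p k - p (k + 1)).trace := by
        simp only [hp, hsucc]
        exact (h.step_mem hs (hmem k)).2.trace_nonneg
      rw [div_mul_eq_mul_div, le_div_iff₀ hs.pos, mul_comm]
      refine h5.trans ?_
      have h7 := hF (k + 1)
      simp only [hp, hsucc] at h6 h7 ⊢
      gcongr
    have h8 : Tendsto (fun k => ‖E k‖ ^ 2) atTop (𝓝 0) :=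
      squeeze_zero (fun k => by positivity) h4 (by simpa using h1.const_mul (2 * m * β / c))
    rw [tendsto_zero_iff_norm_tendsto_zero]
    have h9 := h8.sqrt
    simpa using h9
  have hgL : ric S.gameW S.A (S.Cᵀ * S.C) L = 0 := by
    have hc : Continuous fun X : Matrix (Fin d) (Fin m) ℝ => -(Xᵀ * S.R⁻¹ * X) := by fun_prop
    have h1 := (hc.tendsto 0).comp hE0
    simp only [Matrix.mul_zero, neg_zero] at h1
    exact tendsto_nhds_unique hric (h1.congr fun k => (hgame k).symm)
  refine ⟨L, h.isStab_game hK hLpos (hLle 0) hgL, hLpos, hLle 0, hL, ?_⟩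
  have hc : Continuous fun q : Matrix (Fin d) (Fin m) ℝ × Matrix (Fin m) (Fin m) ℝ =>
      S.R⁻¹ * (q.1 + S.Bᵀ * q.2) := by fun_prop
  have h1 := (hc.tendsto (0, L)).comp (hE0.prodMk_nhds hL)
  simp only [zero_add, ← Matrix.mul_assoc] at h1
  refine h1.congr fun k => ?_
  exact (h.gain_eq (κ k) (p k)).symm

end Regular

end MixedDesign

/-! ### Optimality and local rates -/

theorem exists_lyapunov_bound {m : ℕ} {F : Matrix (Fin m) (Fin m) ℝ} (hF : IsHurwitz F) :
    ∃ c : ℝ, 0 < c ∧ ∀ X : Matrix (Fin m) (Fin m) ℝ, ‖X‖ ≤ c * ‖Fᵀ * X + X * F‖ := by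
  let T : Matrix (Fin m) (Fin m) ℝ →ₗ[ℝ] Matrix (Fin m) (Fin m) ℝ :=
    LinearMap.mulLeft ℝ Fᵀ + LinearMap.mulRight ℝ F
  obtain ⟨c, hc, hT⟩ := T.exists_antilipschitzWith
    (LinearMap.ker_eq_bot'.2 fun X hX => sylvester_injective hF hF hX)
  refine ⟨c, by exact_mod_cast hc, fun X => ?_⟩
  have h := hT.le_mul_dist X 0
  rw [map_zero, dist_zero_right, dist_zero_right] at h
  exact h

/-- For small $a$ one has $Ca^2\le a/2$, which is absorbed on the left. -/
theorem le_of_le_mul_add_sq {a e C : ℝ} (ha : 0 ≤ a) (hC : 0 < C) (h : a ≤ C * (e + a ^ 2))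
    (hs : a ≤ 1 / (2 * C)) : a ≤ 2 * C * e := by
  have h1 : C * a ≤ 1 / 2 := by
    rw [le_div_iff₀ (by positivity)] at hs
    linarith
  nlinarith

/-- Here `a` and `b` are the cost gaps before and after a step and `e` is the squared residual.
Eliminating `e` gives $a\le\lambda(a-b)$ with $\lambda=vt/s$; using $\lambda+1$ keeps the factor in
$(0,1)$. -/
theorem le_mul_of_decrease {a b e s t v : ℝ} (hs : 0 < s) (ht : 0 < t) (hv : 0 < v)
    (h₁ : s * e ≤ t * (a - b)) (h₂ : a ≤ v * e) (hab : b ≤ a) :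
    b ≤ (1 - (v * t / s + 1)⁻¹) * a := by
  have hlam : 0 < v * t / s := by positivity
  have h3 : a ≤ v * t / s * (a - b) := by
    rw [div_mul_eq_mul_div, le_div_iff₀ hs]
    nlinarith
  have h4 : (v * t / s + 1)⁻¹ * a ≤ a - b := by
    rw [inv_mul_le_iff₀ (by positivity)]
    nlinarith
  linarith

namespace MixedDesign

variable {m d n l : ℕ} {S : MixedDesign m d n l}

/-- Convergent iterates eventually enter the neighbourhood, so one constant serves both halves. -/
theorem localRate_of_eventually {step : Matrix (Fin d) (Fin m) ℝ → Matrix (Fin d) (Fin m) ℝ}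
    {Ks : Matrix (Fin d) (Fin m) ℝ} {err : Matrix (Fin d) (Fin m) ℝ → ℝ} {c : ℝ} {p : ℕ}
    (hconv : S.ConvergesTo step Ks)
    (h : ∀ᶠ K in 𝓝 Ks, K ∈ S.feasible → err (step K) ≤ c * err K ^ p) :
    S.LocalRate step Ks err c p := by
  constructor
  · obtain ⟨r, hr, h1⟩ := Metric.eventually_nhds_iff.1 h
    exact ⟨r, hr, fun K hK hKr => h1 (by rwa [dist_eq_norm]) hK⟩
  · intro K₀ hK₀
    obtain ⟨hmem, hlim, -⟩ := hconv K₀ hK₀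
    obtain ⟨N, hN⟩ := eventually_atTop.1 (hlim.eventually h)
    refine ⟨N, fun k hk => ?_⟩
    rw [Function.iterate_succ_apply']
    exact hN k hk (hmem k)

/-- `L` is the stabilizing nonnegative definite solution of the game Riccati equation. -/
structure IsOptimal (S : MixedDesign m d n l) (L : Matrix (Fin m) (Fin m) ℝ) : Prop where
  isStab : IsStab S.gameW S.A (S.Cᵀ * S.C) L
  posSemidef : L.PosSemidef

/-- The gain `R⁻¹ Bᵀ L`. -/
noncomputable def gain (S : MixedDesign m d n l) (L : Matrix (Fin m) (Fin m) ℝ) :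
    Matrix (Fin d) (Fin m) ℝ := S.R⁻¹ * S.Bᵀ * L

namespace Regular

variable (h : S.Regular) {K : Matrix (Fin d) (Fin m) ℝ} {L : Matrix (Fin m) (Fin m) ℝ}
  {step : Matrix (Fin d) (Fin m) ℝ → Matrix (Fin d) (Fin m) ℝ} {M : Matrix (Fin d) (Fin d) ℝ}
  {c : ℝ}
include h

/-- The solution is constructed as the limit of the Gauss–Newton iteration itself. -/
theorem exists_isOptimal (hne : S.feasible.Nonempty) : ∃ L, S.IsOptimal L := by
  obtain ⟨K, hK⟩ := hne
  obtain ⟨c, hc⟩ := h.isDescentStep_gn (η := 1 / 2) (by norm_num) le_rfl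
  obtain ⟨-, L, hL, hLp, -⟩ := h.exists_tendsto_iterate hc hK
  exact ⟨L, hL, hLp⟩

theorem isStab_gain (hL : S.IsOptimal L) :
    IsStab S.W (S.A - S.B * S.gain L) (S.Q (S.gain L)) L := by
  refine ⟨hL.isStab.symm, ?_, ?_⟩
  · have h1 := h.gainRic_eq (S.gain L) hL.isStab.symm
    rw [h.resid_eq_zero_iff.2 (by rfl : S.gain L = _), Matrix.mul_zero, add_zero, hL.isStab.eq] at h1
    exact h1
  · rw [closed_eq_game (by rfl : S.gain L = _)]
    exact hL.isStab.hurwitz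

theorem gain_mem (hL : S.IsOptimal L) : S.gain L ∈ S.feasible := by
  have hst := h.isStab_gain hL
  refine mem_feasible_of_isStab h.γ_pos h.output h.posDef_D ?_ hst
  refine h.isHurwitz_of_supersolution hL.posSemidef ?_
  have h1 : S.gainRic (S.gain L) L = 0 := hst.eq
  rw [h1, neg_zero]
  exact Matrix.PosSemidef.zero

theorem P_gain (hL : S.IsOptimal L) : S.P (S.gain L) = L :=
  (h.P_eq (h.gain_mem hL) (h.isStab_gain hL)).symm

/-- Gauss–Newton started at `K` descends from $P_K$ to a stabilizing solution, which is `L` by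
uniqueness. -/
theorem le_P (hL : S.IsOptimal L) (hK : K ∈ S.feasible) : (S.P K - L).PosSemidef := by
  obtain ⟨c, hc⟩ := h.isDescentStep_gn (η := 1 / 2) (by norm_num) le_rfl
  obtain ⟨-, L', hL', -, hle, -⟩ := h.exists_tendsto_iterate hc hK
  rwa [hL.isStab.unique h.gameW_symm hL']

omit h in
theorem continuous_cost_of_P : Continuous fun P : Matrix (Fin m) (Fin m) ℝ =>
    (P * (S.D * S.Dᵀ)).trace := by fun_prop

theorem convergesTo (hL : S.IsOptimal L) (hs : S.IsDescentStep step M c) :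
    S.ConvergesTo step (S.gain L) := by
  intro K hK
  obtain ⟨hmem, L', hL', -, -, hP, hlim⟩ := h.exists_tendsto_iterate hs hK
  obtain rfl := hL.isStab.unique h.gameW_symm hL'
  refine ⟨hmem, hlim, ?_⟩
  have h1 := ((continuous_cost_of_P (S := S)).tendsto L).comp hP
  rw [cost, h.P_gain hL]
  exact h1

theorem exists_trace_le_cost : ∃ σ : ℝ, 0 < σ ∧ ∀ X : Matrix (Fin m) (Fin m) ℝ, X.PosSemidef →
    σ * X.trace ≤ (X * (S.D * S.Dᵀ)).trace := by
  obtain ⟨σ, hσ, hσD⟩ := h.posDef_D.exists_smul_one_le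
  refine ⟨σ, hσ, fun X hX => ?_⟩
  have h1 := hX.trace_mul_nonneg hσD
  rw [Matrix.mul_sub, Matrix.trace_sub, Matrix.mul_smul, Matrix.mul_one, Matrix.trace_smul,
    smul_eq_mul] at h1
  linarith

omit h in
theorem cost_sub_cost (K K' : Matrix (Fin d) (Fin m) ℝ) :
    S.cost K - S.cost K' = ((S.P K - S.P K') * (S.D * S.Dᵀ)).trace := by
  rw [cost, cost, Matrix.sub_mul, Matrix.trace_sub]

omit h in
theorem trace_mul_le (X : Matrix (Fin m) (Fin m) ℝ) :
    (X * (S.D * S.Dᵀ)).trace ≤ m * ‖S.D * S.Dᵀ‖ * ‖X‖ := by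
  refine (le_abs_self _).trans ((abs_trace_le _).trans ?_)
  rw [mul_assoc, mul_comm ‖S.D * S.Dᵀ‖]
  gcongr
  exact norm_mul_le _ _

/-- $P_K\ge L$ and $DD^\top>0$, so equal costs force $P_K=L$; then the square in `gainRic_eq`
vanishes and determines the gain. -/
theorem isUniqueOptimum (hL : S.IsOptimal L) : S.IsUniqueOptimum (S.gain L) := by
  refine ⟨h.gain_mem hL, fun K hK hne => ?_⟩
  obtain ⟨σ, hσ, hσD⟩ := h.exists_trace_le_cost
  have hX := h.le_P hL hK
  rw [← sub_pos, cost_sub_cost, h.P_gain hL]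
  refine lt_of_lt_of_le ?_ (hσD _ hX)
  refine mul_pos hσ (lt_of_le_of_ne hX.trace_nonneg fun h0 => hne ?_)
  have h1 : S.P K = L := sub_eq_zero.1 (hX.trace_eq_zero_iff.1 h0.symm)
  have h2 := h.gainRic_eq K hL.isStab.symm
  have h3 : S.gainRic K L = 0 := by
    have := (h.isStab hK).eq
    rwa [h1] at this
  rw [h3, hL.isStab.eq, zero_add] at h2
  refine h.resid_eq_zero_iff.1 (h.posDef_R.inv.eq_zero_of_mul_eq_zero ?_)
  refine h.posDef_R.inv.posSemidef.mul_eq_zero_of_trace_quad ?_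
  rw [← h2, Matrix.trace_zero]

/-- Gradient domination: the distance of `P_K` to the optimum is controlled by the residual. -/
theorem exists_norm_sub_le_resid (hL : S.IsOptimal L) : ∃ C : ℝ, 0 < C ∧ ∀ K ∈ S.feasible,
    ‖S.P K - L‖ ≤ C * (‖S.resid K (S.P K)‖ ^ 2 + ‖S.P K - L‖ ^ 2) := by
  obtain ⟨c, hc, hcF⟩ := exists_lyapunov_bound hL.isStab.hurwitz
  refine ⟨c * (‖S.R⁻¹‖ + ‖S.gameW‖ + 1), by positivity, fun K hK => ?_⟩
  set X := S.P K - L with hX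
  set E := S.resid K (S.P K)
  have h1 := ric_sub_ric' S.gameW S.A (S.Cᵀ * S.C) L (S.P K)
  have h2 := h.gainRic_eq K (h.posSemidef_P hK).transpose_eq
  have h3 : S.gainRic K (S.P K) = 0 := (h.isStab hK).eq
  rw [h3] at h2
  rw [hL.isStab.eq, sub_zero, ← transpose_closed h.gameW_symm hL.isStab.symm,
    eq_neg_of_add_eq_zero_left h2.symm] at h1
  -- The residual enters only quadratically, while the linear operator on the left is boundedly
  -- invertible.
  have h4 : (S.A + S.gameW * L)ᵀ * X + X * (S.A + S.gameW * L) =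
      -(Eᵀ * S.R⁻¹ * E) - X * S.gameW * X := by
    rw [h1]; abel
  have h5 : ‖Eᵀ * S.R⁻¹ * E‖ ≤ ‖S.R⁻¹‖ * ‖E‖ ^ 2 := by
    refine (Matrix.l2_opNorm_mul _ _).trans ?_
    have := Matrix.l2_opNorm_mul Eᵀ S.R⁻¹
    rw [norm_transpose] at this
    calc ‖Eᵀ * S.R⁻¹‖ * ‖E‖ ≤ (‖E‖ * ‖S.R⁻¹‖) * ‖E‖ := by gcongr
      _ = _ := by ring
  have h6 : ‖X * S.gameW * X‖ ≤ ‖S.gameW‖ * ‖X‖ ^ 2 := by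
    calc ‖X * S.gameW * X‖ ≤ (‖X‖ * ‖S.gameW‖) * ‖X‖ := by
          refine (norm_mul_le _ _).trans ?_
          gcongr
          exact norm_mul_le _ _
      _ = _ := by ring
  calc ‖X‖ ≤ c * ‖-(Eᵀ * S.R⁻¹ * E) - X * S.gameW * X‖ := by rw [← h4]; exact hcF X
    _ ≤ c * (‖S.R⁻¹‖ * ‖E‖ ^ 2 + ‖S.gameW‖ * ‖X‖ ^ 2) := by
        gcongr
        refine (norm_sub_le _ _).trans ?_
        rw [norm_neg]
        gcongr
    _ ≤ c * ((‖S.R⁻¹‖ + ‖S.gameW‖ + 1) * (‖E‖ ^ 2 + ‖X‖ ^ 2)) := by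
        gcongr
        have e1 := norm_nonneg S.R⁻¹
        have e2 := norm_nonneg S.gameW
        nlinarith [sq_nonneg ‖E‖, sq_nonneg ‖X‖, mul_nonneg e1 (sq_nonneg ‖X‖),
          mul_nonneg e2 (sq_nonneg ‖E‖)]
    _ = _ := by ring

/-- The residual is $R(K-K^*)-B^\top(P_K-L)$; the square of its second part joins the quadratic term
already present. -/
theorem exists_norm_sub_le_gain (hL : S.IsOptimal L) : ∃ C : ℝ, 0 < C ∧ ∀ K ∈ S.feasible,
    ‖S.P K - L‖ ≤ C * (‖K - S.gain L‖ ^ 2 + ‖S.P K - L‖ ^ 2) := by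
  obtain ⟨C, hC, hCE⟩ := h.exists_norm_sub_le_resid hL
  refine ⟨C * (2 * ‖S.R‖ ^ 2 + 2 * ‖S.Bᵀ‖ ^ 2 + 1), by positivity, fun K hK => ?_⟩
  have h1 : S.resid K (S.P K) = S.R * (K - S.gain L) - S.Bᵀ * (S.P K - L) := by
    have h2 : S.R * S.gain L = S.Bᵀ * L := sub_eq_zero.1 (h.resid_eq_zero_iff.2 rfl)
    rw [resid, Matrix.mul_sub, Matrix.mul_sub, h2]
    abel
  set X := S.P K - L
  set Δ := K - S.gain L
  have h3 : ‖S.resid K (S.P K)‖ ≤ ‖S.R‖ * ‖Δ‖ + ‖S.Bᵀ‖ * ‖X‖ := by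
    rw [h1]
    refine (norm_sub_le _ _).trans ?_
    gcongr <;> exact Matrix.l2_opNorm_mul _ _
  have h4 : ‖S.resid K (S.P K)‖ ^ 2 ≤ 2 * ‖S.R‖ ^ 2 * ‖Δ‖ ^ 2 + 2 * ‖S.Bᵀ‖ ^ 2 * ‖X‖ ^ 2 := by
    calc _ ≤ (‖S.R‖ * ‖Δ‖ + ‖S.Bᵀ‖ * ‖X‖) ^ 2 := by gcongr
      _ ≤ _ := by nlinarith [sq_nonneg (‖S.R‖ * ‖Δ‖ - ‖S.Bᵀ‖ * ‖X‖)]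
  calc ‖X‖ ≤ C * (‖S.resid K (S.P K)‖ ^ 2 + ‖X‖ ^ 2) := hCE K hK
    _ ≤ C * ((2 * ‖S.R‖ ^ 2 + 2 * ‖S.Bᵀ‖ ^ 2 + 1) * (‖Δ‖ ^ 2 + ‖X‖ ^ 2)) := by
        gcongr
        have e1 : 0 ≤ ‖S.R‖ ^ 2 * ‖X‖ ^ 2 := by positivity
        have e2 : 0 ≤ ‖S.Bᵀ‖ ^ 2 * ‖Δ‖ ^ 2 := by positivity
        nlinarith [sq_nonneg ‖Δ‖]
    _ = _ := by ring

/-- `K ↦ P_K` is continuous at the optimal gain. -/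
theorem eventually_norm_P_sub_lt (hL : S.IsOptimal L) {ε : ℝ} (hε : 0 < ε) :
    ∀ᶠ K in 𝓝 (S.gain L), K ∈ S.feasible → ‖S.P K - L‖ < ε := by
  -- Perturbation yields some stabilizing solution near `L`; uniqueness identifies it with $P_K$.
  have h1 := (h.isStab_gain hL).eventually_exists h.posDef_W.transpose_eq
    (Metric.ball_mem_nhds L hε)
  have hc : Continuous fun K : Matrix (Fin d) (Fin m) ℝ => (S.A - S.B * K, S.Q K) := by
    unfold Q
    fun_prop
  filter_upwards [(hc.tendsto (S.gain L)).eventually h1] with K hK hKf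
  obtain ⟨P, hPs, hP⟩ := hK posSemidef_Q.transpose_eq
  rw [h.P_eq hKf hP, mem_ball_iff_norm] at hPs
  exact hPs

omit h in
theorem trace_le_card_mul_norm (X : Matrix (Fin m) (Fin m) ℝ) : X.trace ≤ m * ‖X‖ :=
  (le_abs_self _).trans (abs_trace_le X)

theorem exists_linear_rate (hL : S.IsOptimal L) (hs : S.IsDescentStep step M c) :
    ∃ ρ : ℝ, 0 < ρ ∧ ρ < 1 ∧ ∀ᶠ K in 𝓝 (S.gain L), K ∈ S.feasible →
      S.cost (step K) - S.cost (S.gain L) ≤ ρ * (S.cost K - S.cost (S.gain L)) := by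
  obtain ⟨σ, hσ, hσD⟩ := h.exists_trace_le_cost
  obtain ⟨C, hC, hCE⟩ := h.exists_norm_sub_le_resid hL
  -- `k₀` and `p₀` bound $K$ and $P_K$ near the optimum, and `β` the closed loop after the step. The
  -- factor $m$ comes from $\|P_{K'}\|\le\operatorname{tr}P_{K'}\le\operatorname{tr}P_K\le
  -- m\|P_K\|$. The added 1 in `t` and `v` makes them positive in degenerate cases.
  set k₀ := ‖S.gain L‖ + 1 with hk₀
  set p₀ := ‖L‖ + 1 with hp₀
  set β := ‖S.A‖ + ‖S.B‖ * (k₀ + ‖M‖ * (‖S.R‖ * k₀ + ‖S.Bᵀ‖ * p₀)) + ‖S.W‖ * (m * p₀) with hβ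
  have hβ0 : 0 ≤ β := by positivity
  set t := 2 * m * β + 1 with ht
  set v := m * ‖S.D * S.Dᵀ‖ * (2 * C) + 1 with hv
  have ht0 : 0 < t := by positivity
  have hv0 : 0 < v := by positivity
  have hsc : 0 < σ * c := mul_pos hσ hs.pos
  have hlam : 0 < v * t / (σ * c) := by positivity
  refine ⟨1 - (v * t / (σ * c) + 1)⁻¹, sub_pos.2 (inv_lt_one_of_one_lt₀ (by linarith)),
    sub_lt_self _ (by positivity), ?_⟩
  filter_upwards [h.eventually_norm_P_sub_lt hL one_pos,
    h.eventually_norm_P_sub_lt hL (show 0 < 1 / (2 * C) by positivity),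
    Metric.ball_mem_nhds (S.gain L) one_pos] with K h1 h2 h3 hK
  replace h1 := h1 hK
  replace h2 := h2 hK
  rw [mem_ball_iff_norm] at h3
  obtain ⟨hK', hY⟩ := h.step_mem hs hK
  have hdec := h.norm_resid_sq_le hs hK
  set E := S.resid K (S.P K) with hE
  have hPK : ‖S.P K‖ ≤ p₀ := by
    calc ‖S.P K‖ = ‖L + (S.P K - L)‖ := by rw [add_sub_cancel]
      _ ≤ ‖L‖ + ‖S.P K - L‖ := norm_add_le _ _
      _ ≤ p₀ := by rw [hp₀]; gcongr
  have hKn : ‖K‖ ≤ k₀ := by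
    calc ‖K‖ = ‖S.gain L + (K - S.gain L)‖ := by rw [add_sub_cancel]
      _ ≤ ‖S.gain L‖ + ‖K - S.gain L‖ := norm_add_le _ _
      _ ≤ k₀ := by rw [hk₀]; gcongr
  have hEn : ‖E‖ ≤ ‖S.R‖ * k₀ + ‖S.Bᵀ‖ * p₀ := by
    rw [hE, resid]
    refine (norm_sub_le _ _).trans ?_
    gcongr
    · refine (Matrix.l2_opNorm_mul _ _).trans ?_
      gcongr
    · refine (Matrix.l2_opNorm_mul _ _).trans ?_
      gcongr
  have hPK' : ‖S.P (step K)‖ ≤ m * p₀ := by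
    have h4 := hY.trace_nonneg
    rw [Matrix.trace_sub] at h4
    calc ‖S.P (step K)‖ ≤ (S.P (step K)).trace := (h.posSemidef_P hK').norm_le_trace
      _ ≤ (S.P K).trace := by linarith
      _ ≤ m * ‖S.P K‖ := trace_le_card_mul_norm _
      _ ≤ m * p₀ := by gcongr
  have hF : ‖S.A - S.B * step K + S.W * S.P (step K)‖ ≤ β := by
    refine (norm_add_le _ _).trans ?_
    rw [hβ]
    gcongr
    · refine (norm_sub_le _ _).trans ?_
      gcongr
      refine (Matrix.l2_opNorm_mul _ _).trans ?_
      gcongr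
      rw [hs.step_eq]
      refine (norm_sub_le _ _).trans ?_
      gcongr
      refine (Matrix.l2_opNorm_mul _ _).trans ?_
      gcongr
    · refine (norm_mul_le _ _).trans ?_
      gcongr
  have hYtr := hY.trace_nonneg
  have hYcost := hσD _ hY
  rw [← cost_sub_cost] at hYcost
  have hXle := le_of_le_mul_add_sq (norm_nonneg _) hC (hCE K hK) h2.le
  have hXcost := trace_mul_le (S := S) (S.P K - L)
  have hcostX : S.cost K - S.cost (S.gain L) = ((S.P K - L) * (S.D * S.Dᵀ)).trace := by
    rw [cost_sub_cost, h.P_gain hL]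
  refine le_mul_of_decrease (e := ‖E‖ ^ 2) hsc ht0 hv0 ?_ ?_ ?_
  · rw [sub_sub_sub_cancel_right]
    calc σ * c * ‖E‖ ^ 2 = σ * (c * ‖E‖ ^ 2) := by ring
      _ ≤ σ * (2 * m * β * (S.P K - S.P (step K)).trace) := by
          refine mul_le_mul_of_nonneg_left (hdec.trans ?_) hσ.le
          gcongr
      _ = 2 * m * β * (σ * (S.P K - S.P (step K)).trace) := by ring
      _ ≤ 2 * m * β * (S.cost K - S.cost (step K)) := by gcongr
      _ ≤ t * (S.cost K - S.cost (step K)) := by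
          have : 0 ≤ S.cost K - S.cost (step K) := (mul_nonneg hσ.le hYtr).trans hYcost
          rw [ht, add_mul, one_mul]
          linarith
  · rw [hcostX]
    calc _ ≤ m * ‖S.D * S.Dᵀ‖ * ‖S.P K - L‖ := hXcost
      _ ≤ m * ‖S.D * S.Dᵀ‖ * (2 * C * ‖E‖ ^ 2) := by gcongr
      _ = m * ‖S.D * S.Dᵀ‖ * (2 * C) * ‖E‖ ^ 2 := by ring
      _ ≤ v * ‖E‖ ^ 2 := by gcongr; rw [hv]; linarith
  · have : 0 ≤ S.cost K - S.cost (step K) := (mul_nonneg hσ.le hYtr).trans hYcost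
    linarith

omit h in
theorem gnStep_half (K : Matrix (Fin d) (Fin m) ℝ) : S.gnStep (1 / 2) K = S.gain (S.P K) := by
  rw [gnStep, gain]
  norm_num

omit h in
theorem norm_gain_sub_le (P L : Matrix (Fin m) (Fin m) ℝ) :
    ‖S.gain P - S.gain L‖ ≤ ‖S.R⁻¹ * S.Bᵀ‖ * ‖P - L‖ := by
  rw [gain, gain, ← Matrix.mul_sub]
  exact Matrix.l2_opNorm_mul _ _

/-- The new gain depends on $K$ only through $P_K$, linearly, and $P_K-L$ is of second order in
$K-K^*$. -/
theorem exists_quadratic_gain_rate (hL : S.IsOptimal L) :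
    ∃ c : ℝ, 0 < c ∧ ∀ᶠ K in 𝓝 (S.gain L), K ∈ S.feasible →
      ‖S.gnStep (1 / 2) K - S.gain L‖ ≤ c * ‖K - S.gain L‖ ^ 2 := by
  obtain ⟨C, hC, hCK⟩ := h.exists_norm_sub_le_gain hL
  refine ⟨(‖S.R⁻¹ * S.Bᵀ‖ + 1) * (2 * C), by positivity, ?_⟩
  filter_upwards [h.eventually_norm_P_sub_lt hL (show 0 < 1 / (2 * C) by positivity)] with K h1 hK
  have h2 := le_of_le_mul_add_sq (norm_nonneg _) hC (hCK K hK) (h1 hK).le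
  calc _ ≤ ‖S.R⁻¹ * S.Bᵀ‖ * ‖S.P K - L‖ := by
        rw [gnStep_half]; exact norm_gain_sub_le _ _
    _ ≤ (‖S.R⁻¹ * S.Bᵀ‖ + 1) * (2 * C * ‖K - S.gain L‖ ^ 2) := by
        gcongr
        linarith
    _ = _ := by ring

/-- The second-order estimate is applied at $K'$: the new gap is controlled by $\|K'-K^*\|^2$, hence
by $\|P_K-L\|^2$, hence by the square of the old gap. -/
theorem exists_quadratic_cost_rate (hL : S.IsOptimal L) :
    ∃ c : ℝ, 0 < c ∧ ∀ᶠ K in 𝓝 (S.gain L), K ∈ S.feasible →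
      S.cost (S.gnStep (1 / 2) K) - S.cost (S.gain L) ≤
        c * (S.cost K - S.cost (S.gain L)) ^ 2 := by
  obtain ⟨σ, hσ, hσD⟩ := h.exists_trace_le_cost
  obtain ⟨C, hC, hCK⟩ := h.exists_norm_sub_le_gain hL
  obtain ⟨c, hs⟩ := h.isDescentStep_gn (η := 1 / 2) (by norm_num) le_rfl
  set b := ‖S.R⁻¹ * S.Bᵀ‖ with hb
  refine ⟨m * ‖S.D * S.Dᵀ‖ * (2 * C * (b / σ) ^ 2) + 1, by positivity, ?_⟩
  -- The division by $m+1$ lets the smallness pass from $K$ to $K'$ through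
  -- $\|P_{K'}-L\|\le\operatorname{tr}(P_K-L)\le m\|P_K-L\|$.
  filter_upwards [h.eventually_norm_P_sub_lt hL
    (show 0 < 1 / (2 * C) / (m + 1) by positivity)] with K h1 hK
  replace h1 := h1 hK
  obtain ⟨hK', hY⟩ := h.step_mem hs hK
  have hX := h.le_P hL hK
  have hX' := h.le_P hL hK'
  set K' := S.gnStep (1 / 2) K with hK'def
  have h2 : ‖S.P K' - L‖ ≤ 1 / (2 * C) := by
    have h3 := hY.trace_nonneg
    rw [Matrix.trace_sub] at h3
    rw [lt_div_iff₀ (by positivity)] at h1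
    calc ‖S.P K' - L‖ ≤ (S.P K' - L).trace := hX'.norm_le_trace
      _ ≤ (S.P K - L).trace := by rw [Matrix.trace_sub, Matrix.trace_sub]; linarith
      _ ≤ m * ‖S.P K - L‖ := trace_le_card_mul_norm _
      _ ≤ 1 / (2 * C) := by nlinarith [norm_nonneg (S.P K - L)]
  have h4 := le_of_le_mul_add_sq (norm_nonneg _) hC (hCK K' hK') h2
  have h5 : ‖K' - S.gain L‖ ≤ b * ‖S.P K - L‖ := by
    rw [hK'def, gnStep_half]; exact norm_gain_sub_le _ _
  have h6 : ‖S.P K - L‖ ≤ (S.cost K - S.cost (S.gain L)) / σ := by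
    rw [le_div_iff₀ hσ, cost_sub_cost, h.P_gain hL, mul_comm]
    refine le_trans ?_ (hσD _ hX)
    gcongr
    exact hX.norm_le_trace
  set a := S.cost K - S.cost (S.gain L)
  have h7 : ‖K' - S.gain L‖ ≤ b / σ * a := by
    calc _ ≤ b * ‖S.P K - L‖ := h5
      _ ≤ b * (a / σ) := by gcongr
      _ = _ := by ring
  rw [cost_sub_cost, h.P_gain hL]
  calc _ ≤ m * ‖S.D * S.Dᵀ‖ * ‖S.P K' - L‖ := trace_mul_le _
    _ ≤ m * ‖S.D * S.Dᵀ‖ * (2 * C * (b / σ * a) ^ 2) := by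
        gcongr
        exact h4.trans (by gcongr)
    _ = m * ‖S.D * S.Dᵀ‖ * (2 * C * (b / σ) ^ 2) * a ^ 2 := by ring
    _ ≤ _ := by
        gcongr
        linarith

end Regular

end MixedDesign

theorem theoremA3 {m d n l : ℕ} (S : MixedDesign m d n l)
    (hγ : 0 < S.γ)
    (hEC : S.Eᵀ * S.C = 0)
    (hR : S.R.PosDef)
    (hdet : IsDetectable S.A S.C)
    (hDD : (S.D * S.Dᵀ).PosDef)
    (hfeas : S.feasible.Nonempty) :
    (∀ K ∈ S.feasible, S.IsStabilizingSolution K (S.P K) ∧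
      ∀ P, S.IsStabilizingSolution K P → P = S.P K) ∧
    ∃ Ks : Matrix (Fin d) (Fin m) ℝ,
      S.IsUniqueOptimum Ks ∧ Ks = S.R⁻¹ * S.Bᵀ * S.P Ks ∧
      (∀ η : ℝ, 0 < η → η * (2 * ‖S.R‖) ≤ 1 →
        S.ConvergesTo (S.npgStep η) Ks ∧
        ∃ ρ : ℝ, 0 < ρ ∧ ρ < 1 ∧
          S.LocalRate (S.npgStep η) Ks (fun K => S.cost K - S.cost Ks) ρ 1) ∧
      (∀ η : ℝ, 0 < η → η ≤ 1 / 2 →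
        S.ConvergesTo (S.gnStep η) Ks ∧
        ∃ ρ : ℝ, 0 < ρ ∧ ρ < 1 ∧
          S.LocalRate (S.gnStep η) Ks (fun K => S.cost K - S.cost Ks) ρ 1) ∧
      (∃ c : ℝ, 0 < c ∧
        S.LocalRate (S.gnStep (1 / 2)) Ks (fun K => S.cost K - S.cost Ks) c 2) ∧
      (∃ c : ℝ, 0 < c ∧
        S.LocalRate (S.gnStep (1 / 2)) Ks (fun K => ‖K - Ks‖) c 2) := by
  have h : S.Regular := ⟨hγ, hEC, hR, hdet, hDD⟩
  obtain ⟨L, hL⟩ := h.exists_isOptimal hfeas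
  obtain ⟨c₂, hc₂⟩ := h.isDescentStep_gn (η := 1 / 2) (by norm_num) le_rfl
  refine ⟨fun K hK => ⟨h.isStabilizing hK, fun P hP =>
      h.P_eq hK (MixedDesign.isStabilizingSolution_iff.1 hP).2⟩,
    S.gain L, h.isUniqueOptimum hL, by rw [h.P_gain hL]; rfl, fun η hη hηR => ?_,
    fun η hη hη2 => ?_, ?_, ?_⟩
  · have hs := h.isDescentStep_npg hη hηR
    have hconv := h.convergesTo hL hs
    obtain ⟨ρ, h0, h1, hρ⟩ := h.exists_linear_rate hL hs
    exact ⟨hconv, ρ, h0, h1, MixedDesign.localRate_of_eventually hconv (by simpa using hρ)⟩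
  · obtain ⟨c, hs⟩ := h.isDescentStep_gn hη hη2
    have hconv := h.convergesTo hL hs
    obtain ⟨ρ, h0, h1, hρ⟩ := h.exists_linear_rate hL hs
    exact ⟨hconv, ρ, h0, h1, MixedDesign.localRate_of_eventually hconv (by simpa using hρ)⟩
  · obtain ⟨c, h0, hc⟩ := h.exists_quadratic_cost_rate hL
    exact ⟨c, h0, MixedDesign.localRate_of_eventually (h.convergesTo hL hc₂) hc⟩
  · obtain ⟨c, h0, hc⟩ := h.exists_quadratic_gain_rate hL
    exact ⟨c, h0, MixedDesign.localRate_of_eventually (h.convergesTo hL hc₂) hc⟩
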